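/- Let $\Omega\subset\mathbb R^2$ be a bounded polygonal domain with Lipschitz boundary, let $n\ge 0$ and $q^1,\dots,q^n\in\mathbb R$, let $\epsilon:\bar\Omega\to\mathbb R$ be smooth with $\epsilon>0$ on $\bar\Omega$, and let $\sigma>0$. Write $(\cdot,\cdot)$ and $\|\cdot\|_{0}=\|\cdot\|_{0,\Omega}$ for the inner product and norm of $L^2(\Omega)$, and $\|\cdot\|_{0,\tau}$ for the norm of $L^2(\tau)$. Then there is a constant $C>0$, depending only on $\Omega$, $n$, $(q^i)$, $\epsilon$ and $\sigma$, such that the following holds. Let $\alpha,\gamma,g:\bar\Omega\times\mathbb R\to\mathbb R$ and $\beta:\bar\Omega\times\mathbb R\to\mathbb R^2$ be smooth and $f\in L^2(\Omega)$. Let $p^1,\dots,p^n,\phi\in H^1_0(\Omega)$ be a weak solution of the steady-state nonlinear Poisson--Nernst--Planck system, i.e. (with all integrals absolutely convergent) for all $v,w\in H_0^1(\Omega)$ and $1\le i\le n$, $$(\alpha(\cdot,p^i)\nabla p^i+\beta(\cdot,p^i),\nabla v)+(g(\cdot,p^i),v)+(\gamma(\cdot,p^i)\nabla\phi,\nabla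 v)=0,\qquad (\epsilon\nabla\phi,\nabla w)=\Big(\sum_{i=1}^n q^ip^i+f,\,w\Big).$$ Let $\mathcal T^h$ be a conforming triangulation of $\Omega$ that is shape regular with constant $\sigma$: each $\tau\in\mathcal T^h$, of diameter $h_\tau$, contains a disc of radius $r>0$ with $h_\tau\le\sigma r$. Let $S^h=\{v\in H^1(\Omega): v|_\tau \text{ is affine for all }\tau\in\mathcal T^h\}$, let $S^h_0=S^h\cap H^1_0(\Omega)$, and let $\varphi_z\in S^h$ be the nodal basis function of the vertex $z$. Let $p_h^1,\dots,p_h^n,\phi_h\in S_0^h$ satisfy the same two equations with $(p^i,\phi)$ replaced by $(p^i_h,\phi_h)$, for all $v,w\in S_0^h$. For each vertex $z$ let $\alpha_z^\tau\ge 0$ ($\tau\in\mathcal T^h$ having $z$ as a vertex) be weights with $\sum_{\tau}\alpha_z^\tau=1$, and let $$G_h\phi_h=\sum_{z}\Big(\sum_{\tau\ni z}\alpha_z^\tau\,\epsilon(z)\,(\nabla\phi_h)|_\tau\Big)\varphi_z$$ be the local-averaging flux recovery, the outer sum being over all vertices of $\mathcal T^h$. Then $$\|\nabla(\phi-\phi_h)\|_{0}\le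 C\Big(\eta_\phi+\sum_{i=1}^n\|p^i-p_h^i\|_{0}\Big),\qquad \eta_\phi=\sum_{\tau\in\mathcal T^h}\Big(h_\tau\|R_{1h}\|_{0,\tau}+\|D_h(\phi_h)\|_{0,\tau}\Big),$$ where $R_{1h}=\sum_{i=1}^n q^ip_h^i+\operatorname{div}(G_h\phi_h)+f$ and $D_h(\phi_h)=G_h\phi_h-\epsilon\nabla\phi_h$. -/

import Mathlib

open MeasureTheory
open scoped ContDiff

noncomputable section

namespace PNP

/-- The Euclidean plane. -/
abbrev Plane : Type := EuclideanSpace ℝ (Fin 2)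

/-! ### Domains -/

/-- Near each boundary point, in suitable orthonormal coordinates, `Ω` is the region strictly above
the graph of a Lipschitz function. -/
def HasLipschitzBoundary (Ω : Set Plane) : Prop :=
  ∀ x ∈ frontier Ω, ∃ r : ℝ, 0 < r ∧ ∃ (e : Plane ≃ᵃⁱ[ℝ] Plane) (K : NNReal) (ψ : ℝ → ℝ),
    LipschitzWith K ψ ∧ ∀ y ∈ Metric.ball x r, (y ∈ Ω ↔ ψ (e y 0) < e y 1)

/-- Bounded polygonal domains (nonempty, open and connected) with Lipschitz boundary. -/
structure IsPolygonalDomain (Ω : Set Plane) : Prop where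
  isOpen : IsOpen Ω
  isConnected : IsConnected Ω
  isBounded : Bornology.IsBounded Ω
  polygonal : ∃ S : Finset (Plane × Plane), frontier Ω = ⋃ s ∈ S, segment ℝ s.1 s.2
  lipschitz : HasLipschitzBoundary Ω

/-! ### Sobolev spaces -/

/-- `C_c^∞(Ω)`. -/
def IsTestFunction (Ω : Set Plane) (ψ : Plane → ℝ) : Prop :=
  ContDiff ℝ ∞ ψ ∧ HasCompactSupport ψ ∧ tsupport ψ ⊆ Ω

/-- `u ∈ L²(Ω)` has the weak gradient `G ∈ L²(Ω)²`. -/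
def HasWeakGrad (Ω : Set Plane) (u : Plane → ℝ) (G : Plane → Plane) : Prop :=
  MemLp u 2 (volume.restrict Ω) ∧ MemLp G 2 (volume.restrict Ω) ∧
    ∀ ψ : Plane → ℝ, IsTestFunction Ω ψ → ∀ y : Plane,
      ∫ x in Ω, u x * fderiv ℝ ψ x y = -∫ x in Ω, inner ℝ (G x) y * ψ x

/-- `H¹(Ω)`. -/
def MemH1 (Ω : Set Plane) (u : Plane → ℝ) : Prop := ∃ G, HasWeakGrad Ω u G

open Classical in
/-- The weak gradient of a function in `H¹(Ω)` (unique up to null sets in `Ω`). -/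
def weakGrad (Ω : Set Plane) (u : Plane → ℝ) : Plane → Plane :=
  if h : MemH1 Ω u then h.choose else 0

/-- `H¹₀(Ω)`, the closure of `C_c^∞(Ω)` in `H¹(Ω)`. -/
def MemH10 (Ω : Set Plane) (u : Plane → ℝ) : Prop :=
  MemH1 Ω u ∧ ∀ δ : ENNReal, 0 < δ → ∃ ψ : Plane → ℝ, IsTestFunction Ω ψ ∧
    eLpNorm (fun x => u x - ψ x) 2 (volume.restrict Ω) < δ ∧
    eLpNorm (fun x => weakGrad Ω u x - gradient ψ x) 2 (volume.restrict Ω) < δ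

/-- The norm `‖F‖_{0,S}` of `L²(S)`, for scalar or vector fields. -/
def l2norm {V : Type*} [NormedAddCommGroup V] (S : Set Plane) (F : Plane → V) : ℝ :=
  (eLpNorm F 2 (volume.restrict S)).toReal

/-! ### Triangulations and finite elements -/

/-- A conforming triangulation of `Ω`. A triangle is given by the set of its three vertices, and
two closed triangles meet exactly in the convex hull of their common vertices. -/
structure Triangulation (Ω : Set Plane) where
  cells : Finset (Finset Plane)
  card_eq : ∀ t ∈ cells, t.card = 3
  indep : ∀ t ∈ cells, AffineIndependent ℝ (fun z : t => (z : Plane))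
  inter : ∀ s ∈ cells, ∀ t ∈ cells,
    convexHull ℝ (s : Set Plane) ∩ convexHull ℝ (t : Set Plane)
      = convexHull ℝ ((s : Set Plane) ∩ (t : Set Plane))
  cover : ⋃ t ∈ cells, convexHull ℝ (t : Set Plane) = closure Ω

/-- The closed triangle with vertex set `t`. -/
def tri (t : Finset Plane) : Set Plane := convexHull ℝ (t : Set Plane)

/-- The diameter `h_τ`. -/
def cellDiam (t : Finset Plane) : ℝ := Metric.diam (tri t)

namespace Triangulation

variable {Ω : Set Plane}

/-- Shape regularity with constant `σ`: each triangle contains a disc of radius `r > 0` with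
`h_τ ≤ σ r`. -/
def ShapeRegular (T : Triangulation Ω) (σ : ℝ) : Prop :=
  ∀ t ∈ T.cells, ∃ (x : Plane) (r : ℝ), 0 < r ∧ Metric.closedBall x r ⊆ tri t ∧
    cellDiam t ≤ σ * r

open Classical in
/-- The set of all vertices. -/
def vertices (T : Triangulation Ω) : Finset Plane := T.cells.biUnion id

/-- The linear finite element space `S^h`: functions in `H¹(Ω)` that are affine on each (closed)
triangle. -/
def MemS (T : Triangulation Ω) (v : Plane → ℝ) : Prop :=
  MemH1 Ω v ∧ ∀ t ∈ T.cells, ∃ l : Plane →ᵃ[ℝ] ℝ, Set.EqOn v l (tri t)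

/-- `S^h_0 = S^h ∩ H¹₀(Ω)`. -/
def MemS0 (T : Triangulation Ω) (v : Plane → ℝ) : Prop := T.MemS v ∧ MemH10 Ω v

/-- The vertices of a triangle as an affine basis of the plane; its coordinates are the barycentric
coordinates of the triangle. -/
def affineBasis (T : Triangulation Ω) (t : Finset Plane) (ht : t ∈ T.cells) :
    AffineBasis t ℝ Plane where
  toFun := fun z => (z : Plane)
  ind' := T.indep t ht
  tot' := by
    rw [(T.indep t ht).affineSpan_eq_top_iff_card_eq_finrank_add_one]
    simp [T.card_eq t ht]

open Classical in
/-- The nodal basis function `φ_z`: on a triangle with vertex `z` it is the barycentric coordinate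
belonging to `z` (the same for all such triangles through the point), elsewhere it vanishes. -/
def nodalBasis (T : Triangulation Ω) (z x : Plane) : ℝ :=
  if h : ∃ t, ∃ _ : t ∈ T.cells, z ∈ t ∧ x ∈ tri t then
    (T.affineBasis h.choose h.choose_spec.1).coord ⟨z, h.choose_spec.2.1⟩ x
  else 0

open Classical in
/-- Admissible averaging weights `α_z^τ`, for `τ` in the patch of `z`: nonnegative with sum one. -/
def IsAveragingWeight (T : Triangulation Ω) (wt : Plane → Finset Plane → ℝ) : Prop :=
  ∀ z ∈ T.vertices, (∀ t ∈ T.cells, z ∈ t → 0 ≤ wt z t) ∧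
    ∑ t ∈ T.cells with z ∈ t, wt z t = 1

/-- The constant gradient on a triangle `t` of a function that is affine on `t`, evaluated at the
centroid, an interior point of `t`. -/
def cellGrad (v : Plane → ℝ) (t : Finset Plane) : Plane := gradient v (t.centroid ℝ id)

open Classical in
/-- The recovered flux `G_h v = ∑_z (∑_{τ ∋ z} α_z^τ ε(z) (∇v)|_τ) φ_z`. -/
def fluxRecovery (T : Triangulation Ω) (wt : Plane → Finset Plane → ℝ) (ε : Plane → ℝ)
    (v : Plane → ℝ) (x : Plane) : Plane :=
  ∑ z ∈ T.vertices, T.nodalBasis z x •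
    ∑ t ∈ T.cells with z ∈ t, wt z t • ε z • cellGrad v t

end Triangulation

/-- The divergence of a vector field; for a piecewise affine field it is defined off the edges. -/
def divergence (F : Plane → Plane) (x : Plane) : ℝ :=
  ∑ k : Fin 2, fderiv ℝ F x (EuclideanSpace.single k 1) k

/-! ### The Poisson–Nernst–Planck system -/

/-- `a(w,v) = (α(·,w)∇w + β(·,w), ∇v) + (g(·,w), v)`. -/
def formA (Ω : Set Plane) (α : Plane → ℝ → ℝ) (β : Plane → ℝ → Plane) (g : Plane → ℝ → ℝ)
    (w v : Plane → ℝ) : ℝ :=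
  (∫ x in Ω, inner ℝ (α x (w x) • weakGrad Ω w x + β x (w x)) (weakGrad Ω v x))
    + ∫ x in Ω, g x (w x) * v x

/-- `b(w,ψ,v) = (γ(·,w)∇ψ, ∇v)`. -/
def formB (Ω : Set Plane) (γ : Plane → ℝ → ℝ) (w ψ v : Plane → ℝ) : ℝ :=
  ∫ x in Ω, inner ℝ (γ x (w x) • weakGrad Ω ψ x) (weakGrad Ω v x)

/-- `ã(w,v) = (ε∇w, ∇v)`. -/
def formE (Ω : Set Plane) (ε : Plane → ℝ) (w v : Plane → ℝ) : ℝ :=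
  ∫ x in Ω, inner ℝ (ε x • weakGrad Ω w x) (weakGrad Ω v x)

/-- The charge `f̃(p) = ∑ qⁱ pⁱ + f`. -/
def charge {n : ℕ} (q : Fin n → ℝ) (f : Plane → ℝ) (p : Fin n → Plane → ℝ) (x : Plane) : ℝ :=
  ∑ i, q i * p i x + f x

/-- Weak solutions `(p¹, …, pⁿ, φ)` of the system with homogeneous Dirichlet conditions. The
integrals of the nonlinear forms are required to converge absolutely. -/
structure IsWeakSolution (Ω : Set Plane) {n : ℕ} (q : Fin n → ℝ)
    (α : Plane → ℝ → ℝ) (β : Plane → ℝ → Plane) (γ g : Plane → ℝ → ℝ) (ε f : Plane → ℝ)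
    (p : Fin n → Plane → ℝ) (φ : Plane → ℝ) : Prop where
  p_mem : ∀ i, MemH10 Ω (p i)
  phi_mem : MemH10 Ω φ
  integrable_flux : ∀ i, ∀ v, MemH10 Ω v → IntegrableOn
    (fun x => inner ℝ (α x (p i x) • weakGrad Ω (p i) x + β x (p i x)) (weakGrad Ω v x)) Ω
  integrable_reaction : ∀ i, ∀ v, MemH10 Ω v → IntegrableOn (fun x => g x (p i x) * v x) Ω
  integrable_drift : ∀ i, ∀ v, MemH10 Ω v → IntegrableOn
    (fun x => inner ℝ (γ x (p i x) • weakGrad Ω φ x) (weakGrad Ω v x)) Ω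
  concentration : ∀ i, ∀ v, MemH10 Ω v → formA Ω α β g (p i) v + formB Ω γ (p i) φ v = 0
  potential : ∀ w, MemH10 Ω w → formE Ω ε φ w = ∫ x in Ω, charge q f p x * w x

/-- Finite element solutions `(p¹_h, …, pⁿ_h, φ_h)` in `S^h_0`. -/
structure IsFESolution {Ω : Set Plane} (T : Triangulation Ω) {n : ℕ} (q : Fin n → ℝ)
    (α : Plane → ℝ → ℝ) (β : Plane → ℝ → Plane) (γ g : Plane → ℝ → ℝ) (ε f : Plane → ℝ)
    (ph : Fin n → Plane → ℝ) (φh : Plane → ℝ) : Prop where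
  p_mem : ∀ i, T.MemS0 (ph i)
  phi_mem : T.MemS0 φh
  concentration : ∀ i, ∀ v, T.MemS0 v → formA Ω α β g (ph i) v + formB Ω γ (ph i) φh v = 0
  potential : ∀ w, T.MemS0 w → formE Ω ε φh w = ∫ x in Ω, charge q f ph x * w x

/-! ### The error estimator -/

/-- `R_{1h} = ∑ qⁱ pⁱ_h + div(G_h φ_h) + f`. -/
def residual {Ω : Set Plane} (T : Triangulation Ω) (wt : Plane → Finset Plane → ℝ)
    {n : ℕ} (q : Fin n → ℝ) (ε f : Plane → ℝ) (ph : Fin n → Plane → ℝ) (φh : Plane → ℝ)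
    (x : Plane) : ℝ :=
  ∑ i, q i * ph i x + divergence (T.fluxRecovery wt ε φh) x + f x

/-- `D_h(φ_h) = G_h φ_h - ε∇φ_h`. -/
def fluxDefect {Ω : Set Plane} (T : Triangulation Ω) (wt : Plane → Finset Plane → ℝ)
    (ε : Plane → ℝ) (φh : Plane → ℝ) (x : Plane) : Plane :=
  T.fluxRecovery wt ε φh x - ε x • weakGrad Ω φh x

/-- `η_φ = ∑_τ (h_τ ‖R_{1h}‖_{0,τ} + ‖D_h(φ_h)‖_{0,τ})`. -/
def estimator {Ω : Set Plane} (T : Triangulation Ω) (wt : Plane → Finset Plane → ℝ)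
    {n : ℕ} (q : Fin n → ℝ) (ε f : Plane → ℝ) (ph : Fin n → Plane → ℝ) (φh : Plane → ℝ) : ℝ :=
  ∑ t ∈ T.cells, (cellDiam t * l2norm (tri t) (residual T wt q ε f ph φh)
    + l2norm (tri t) (fluxDefect T wt ε φh))

end PNP

end

/-!
Let `e = φ - φ_h`, and let `w ∈ S^h_0` be a quasi-interpolant of `e`. The recovered flux `G` is
continuous and piecewise affine, so integration by parts and Galerkin orthogonality give
`(ε∇e, ∇e) = (∑ qⁱ(pⁱ - pⁱ_h), e) + (R_{1h}, e - w) + (D_h(φ_h), ∇(e - w))`.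
The Cauchy–Schwarz inequality on each triangle, the bounds `‖e - w‖_τ ≤ M h_τ ‖∇e‖` and
`‖∇(e - w)‖_τ ≤ M ‖∇e‖`, the Poincaré inequality and `ε ≥ ε₀ > 0` then yield the estimate.

The nodal values of `w` are values of `e`, extended by zero, at points of small discs about the
vertices chosen such that a Poincaré inequality with this value in place of the mean holds. If the
basis function of a vertex does not vanish on the boundary, the disc is taken in the exterior of
`Ω`, where `e` vanishes; such discs of comparable size exist as the boundary is Lipschitz. That
`w ∈ H¹₀(Ω)` follows because a Lipschitz function vanishing off `Ω` becomes compactly supported in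
`Ω` after subtracting its truncation to `[-δ, δ]`, whose gradient tends to zero in `L²` as `δ → 0`.
-/

noncomputable section

namespace PNP

variable {Ω : Set Plane}

/-! ### Square-integrable functions -/

section SquareIntegrable

variable {X V : Type*} [MeasurableSpace X] {μ : Measure X} [NormedAddCommGroup V]

lemma eLpNorm_two_sq (μ : Measure X) (F : X → V) : eLpNorm F 2 μ ^ 2 = ∫⁻ x, ‖F x‖ₑ ^ 2 ∂μ := by
  simpa using eLpNorm_nnreal_pow_eq_lintegral (f := F) (μ := μ) (p := 2) two_ne_zero

variable [InnerProductSpace ℝ V] {F G : X → V}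

lemma inner_toLp_eq_integral (hF : MemLp F 2 μ) (hG : MemLp G 2 μ) :
    inner ℝ hF.toLp hG.toLp = ∫ x, inner ℝ (F x) (G x) ∂μ := by
  rw [L2.inner_def]
  refine integral_congr_ae ?_
  filter_upwards [hF.coeFn_toLp, hG.coeFn_toLp] with x hFx hGx
  rw [hFx, hGx]

lemma integrable_inner_of_memLp (hF : MemLp F 2 μ) (hG : MemLp G 2 μ) :
    Integrable (fun x => inner ℝ (F x) (G x)) μ := by
  refine (L2.integrable_inner (𝕜 := ℝ) hF.toLp hG.toLp).congr ?_
  filter_upwards [hF.coeFn_toLp, hG.coeFn_toLp] with x hFx hGx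
  rw [hFx, hGx]

lemma abs_integral_inner_le (hF : MemLp F 2 μ) (hG : MemLp G 2 μ) :
    |∫ x, inner ℝ (F x) (G x) ∂μ| ≤ (eLpNorm F 2 μ).toReal * (eLpNorm G 2 μ).toReal := by
  rw [← inner_toLp_eq_integral hF hG, ← Lp.norm_toLp F hF, ← Lp.norm_toLp G hG]
  exact abs_real_inner_le_norm _ _

lemma abs_integral_mul_le {f g : X → ℝ} (hf : MemLp f 2 μ) (hg : MemLp g 2 μ) :
    |∫ x, f x * g x ∂μ| ≤ (eLpNorm f 2 μ).toReal * (eLpNorm g 2 μ).toReal := by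
  simpa [mul_comm] using abs_integral_inner_le hf hg

lemma sq_toReal_eLpNorm (hF : MemLp F 2 μ) :
    (eLpNorm F 2 μ).toReal ^ 2 = ∫ x, inner ℝ (F x) (F x) ∂μ := by
  rw [← inner_toLp_eq_integral hF hF, ← Lp.norm_toLp F hF, real_inner_self_eq_norm_sq]

end SquareIntegrable

section L2Norm

variable {V W : Type*} [NormedAddCommGroup V] [NormedAddCommGroup W] {S : Set Plane}

lemma l2norm_nonneg (S : Set Plane) (F : Plane → V) : 0 ≤ l2norm S F := ENNReal.toReal_nonneg

lemma l2norm_congr {F G : Plane → V} (h : F =ᵐ[volume.restrict S] G) :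
    l2norm S F = l2norm S G := by
  rw [l2norm, l2norm, eLpNorm_congr_ae h]

lemma l2norm_le_mul {F : Plane → V} {G : Plane → W} {c : ℝ} (hc : 0 ≤ c)
    (hG : MemLp G 2 (volume.restrict S))
    (h : ∀ᵐ x ∂volume.restrict S, ‖F x‖ ≤ c * ‖G x‖) : l2norm S F ≤ c * l2norm S G := by
  simpa only [l2norm, ENNReal.toReal_mul, ENNReal.toReal_ofReal hc] using
    ENNReal.toReal_mono (ENNReal.mul_ne_top (by simp) hG.2.ne)
      (eLpNorm_le_mul_eLpNorm_of_ae_le_mul h 2)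

lemma l2norm_sum_le {ι : Type*} (s : Finset ι) (F : ι → Plane → V)
    (hF : ∀ i ∈ s, MemLp (F i) 2 (volume.restrict S)) :
    l2norm S (fun x => ∑ i ∈ s, F i x) ≤ ∑ i ∈ s, l2norm S (F i) := by
  have hle := eLpNorm_sum_le (fun i hi => (hF i hi).1) (p := 2) (by norm_num)
  simpa only [l2norm, ENNReal.toReal_sum fun i hi => (hF i hi).2.ne, Finset.sum_fn] using
    ENNReal.toReal_mono (ENNReal.sum_ne_top.2 fun i hi => (hF i hi).2.ne) hle

lemma l2norm_sub_le {F G : Plane → V} (hF : MemLp F 2 (volume.restrict S))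
    (hG : MemLp G 2 (volume.restrict S)) :
    l2norm S (fun x => F x - G x) ≤ l2norm S F + l2norm S G := by
  have hle := eLpNorm_sub_le hF.1 hG.1 (p := 2) (by norm_num)
  simpa only [l2norm, Pi.sub_def, ENNReal.toReal_add hF.2.ne hG.2.ne] using
    ENNReal.toReal_mono (ENNReal.add_ne_top.2 ⟨hF.2.ne, hG.2.ne⟩) hle

lemma l2norm_mono_measure {S' : Set Plane} {F : Plane → V}
    (h : (volume : Measure Plane).restrict S ≤ volume.restrict S')
    (hF : MemLp F 2 (volume.restrict S')) : l2norm S F ≤ l2norm S' F :=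
  ENNReal.toReal_mono hF.2.ne (eLpNorm_mono_measure F h)

end L2Norm

/-! ### Test functions and weak gradients -/

namespace IsTestFunction

variable {ψ χ : Plane → ℝ}

lemma differentiable (hψ : IsTestFunction Ω ψ) : Differentiable ℝ ψ :=
  hψ.1.differentiable (by simp)

lemma sub (hψ : IsTestFunction Ω ψ) (hχ : IsTestFunction Ω χ) :
    IsTestFunction Ω (fun x => ψ x - χ x) :=
  ⟨hψ.1.sub hχ.1, hψ.2.1.sub hχ.2.1, (tsupport_sub ψ χ).trans (Set.union_subset hψ.2.2 hχ.2.2)⟩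

lemma gradient_sub (hψ : IsTestFunction Ω ψ) (hχ : IsTestFunction Ω χ) (x : Plane) :
    gradient (fun x => ψ x - χ x) x = gradient ψ x - gradient χ x := by
  simp [gradient, fderiv_fun_sub (hψ.differentiable x) (hχ.differentiable x)]

lemma continuous_gradient (hψ : IsTestFunction Ω ψ) : Continuous (gradient ψ) :=
  (LinearIsometryEquiv.continuous _).comp (hψ.1.continuous_fderiv (by simp))

lemma eq_zero (hψ : IsTestFunction Ω ψ) {x : Plane} (hx : x ∉ Ω) : ψ x = 0 :=
  image_eq_zero_of_notMem_tsupport fun h => hx (hψ.2.2 h)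

lemma fderiv_eq_zero (hψ : IsTestFunction Ω ψ) {x : Plane} (hx : x ∉ Ω) : fderiv ℝ ψ x = 0 :=
  fderiv_of_notMem_tsupport ℝ fun h => hx (hψ.2.2 h)

lemma gradient_eq_zero (hψ : IsTestFunction Ω ψ) {x : Plane} (hx : x ∉ Ω) :
    gradient ψ x = 0 := by
  simp [gradient, hψ.fderiv_eq_zero hx]

lemma memLp (hψ : IsTestFunction Ω ψ) (p : ENNReal) (μ : Measure Plane)
    [IsFiniteMeasureOnCompacts μ] : MemLp ψ p μ :=
  hψ.1.continuous.memLp_of_hasCompactSupport hψ.2.1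

lemma memLp_gradient (hψ : IsTestFunction Ω ψ) (p : ENNReal) (μ : Measure Plane)
    [IsFiniteMeasureOnCompacts μ] : MemLp (gradient ψ) p μ :=
  hψ.continuous_gradient.memLp_of_hasCompactSupport
    ((hψ.2.1.fderiv (𝕜 := ℝ)).comp_left (map_zero _))

lemma memLp_fderiv_apply (hψ : IsTestFunction Ω ψ) (p : ENNReal) (μ : Measure Plane)
    [IsFiniteMeasureOnCompacts μ] (y : Plane) : MemLp (fun x => fderiv ℝ ψ x y) p μ := by
  simpa only [inner_gradient_left] using (hψ.memLp_gradient p μ).inner_const (𝕜 := ℝ) y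

lemma integrable_inner_mul (hψ : IsTestFunction Ω ψ) {G : Plane → Plane}
    (hG : MemLp G 2 (volume.restrict Ω)) (y : Plane) :
    Integrable (fun x => inner ℝ (G x) y * ψ x) (volume.restrict Ω) :=
  (hG.inner_const y).integrable_mul (hψ.memLp 2 _)

end IsTestFunction

section WeakGradient

variable {u v : Plane → ℝ} {G H : Plane → Plane}

lemma HasWeakGrad.sub (hG : HasWeakGrad Ω u G) (hH : HasWeakGrad Ω v H) :
    HasWeakGrad Ω (fun x => u x - v x) (fun x => G x - H x) := by
  refine ⟨hG.1.sub hH.1, hG.2.1.sub hH.2.1, fun ψ hψ y => ?_⟩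
  have hd := hψ.memLp_fderiv_apply 2 (volume.restrict Ω) y
  have hu : Integrable (fun x => u x * fderiv ℝ ψ x y) (volume.restrict Ω) :=
    hG.1.integrable_mul hd
  have hv : Integrable (fun x => v x * fderiv ℝ ψ x y) (volume.restrict Ω) :=
    hH.1.integrable_mul hd
  simp_rw [inner_sub_left, sub_mul]
  rw [integral_sub hu hv, integral_sub (hψ.integrable_inner_mul hG.2.1 y)
    (hψ.integrable_inner_mul hH.2.1 y), hG.2.2 ψ hψ y, hH.2.2 ψ hψ y]
  ring

lemma HasWeakGrad.integral_smul_eq_zero (hG : HasWeakGrad Ω (fun _ => 0) G) {ψ : Plane → ℝ}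
    (hψ : IsTestFunction Ω ψ) : ∫ x in Ω, ψ x • G x = 0 := by
  refine ext_inner_left ℝ fun y => ?_
  have hint : Integrable (fun x => ψ x • G x) (volume.restrict Ω) :=
    memLp_one_iff_integrable.1 (hG.2.1.smul (hψ.memLp 2 _))
  rw [← integral_inner hint]
  simpa [inner_smul_right, real_inner_comm, mul_comm] using hG.2.2 ψ hψ y

lemma HasWeakGrad.ae_eq (hΩ : IsOpen Ω) (hG : HasWeakGrad Ω u G) (hH : HasWeakGrad Ω u H) :
    G =ᵐ[volume.restrict Ω] H := by
  have hGH : HasWeakGrad Ω (fun _ => 0) (fun x => G x - H x) := by simpa using hG.sub hH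
  have hzero : ∀ᵐ x, x ∈ Ω → G x - H x = 0 := by
    refine hΩ.ae_eq_zero_of_integral_contDiff_smul_eq_zero
      (locallyIntegrableOn_of_locallyIntegrable_restrict
        (hGH.2.1.locallyIntegrable one_le_two)) fun ψ hψ hc hsupp => ?_
    have hψ' : IsTestFunction Ω ψ := ⟨hψ, hc, hsupp⟩
    rw [← hGH.integral_smul_eq_zero hψ', setIntegral_eq_integral_of_forall_compl_eq_zero]
    intro x hx
    rw [hψ'.eq_zero hx, zero_smul]
  filter_upwards [(ae_restrict_iff' hΩ.measurableSet).2 hzero] with x hx using sub_eq_zero.1 hx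

lemma MemH1.hasWeakGrad (hu : MemH1 Ω u) : HasWeakGrad Ω u (weakGrad Ω u) := by
  rw [weakGrad, dif_pos hu]
  exact hu.choose_spec

lemma HasWeakGrad.weakGrad_ae_eq (hΩ : IsOpen Ω) (hG : HasWeakGrad Ω u G) :
    weakGrad Ω u =ᵐ[volume.restrict Ω] G :=
  (MemH1.hasWeakGrad ⟨G, hG⟩).ae_eq hΩ hG

lemma weakGrad_sub_ae_eq (hΩ : IsOpen Ω) (hu : MemH1 Ω u) (hv : MemH1 Ω v) :
    weakGrad Ω (fun x => u x - v x)
      =ᵐ[volume.restrict Ω] fun x => weakGrad Ω u x - weakGrad Ω v x :=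
  (hu.hasWeakGrad.sub hv.hasWeakGrad).weakGrad_ae_eq hΩ

lemma MemH10.memLp (hu : MemH10 Ω u) : MemLp u 2 (volume.restrict Ω) :=
  hu.1.hasWeakGrad.1

lemma MemH10.memLp_weakGrad (hu : MemH10 Ω u) : MemLp (weakGrad Ω u) 2 (volume.restrict Ω) :=
  hu.1.hasWeakGrad.2.1

lemma MemH10.sub (hΩ : IsOpen Ω) (hu : MemH10 Ω u) (hv : MemH10 Ω v) :
    MemH10 Ω (fun x => u x - v x) := by
  refine ⟨⟨_, hu.1.hasWeakGrad.sub hv.1.hasWeakGrad⟩, fun δ hδ => ?_⟩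
  obtain ⟨ψ, hψ, hψu, hψg⟩ := hu.2 _ (ENNReal.half_pos hδ.ne')
  obtain ⟨χ, hχ, hχv, hχg⟩ := hv.2 _ (ENNReal.half_pos hδ.ne')
  refine ⟨fun x => ψ x - χ x, hψ.sub hχ, ?_, ?_⟩ <;> rw [← ENNReal.add_halves δ]
  · have hdiff : (fun x => u x - v x - (ψ x - χ x))
        = (fun x => u x - ψ x) - fun x => v x - χ x := funext fun x => sub_sub_sub_comm _ _ _ _
    rw [hdiff]
    exact (eLpNorm_sub_le (hu.memLp.sub (hψ.memLp 2 _)).1 (hv.memLp.sub (hχ.memLp 2 _)).1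
      one_le_two).trans_lt (ENNReal.add_lt_add hψu hχv)
  · have hgrad : (fun x => weakGrad Ω (fun x => u x - v x) x - gradient (fun x => ψ x - χ x) x)
        =ᵐ[volume.restrict Ω]
        (fun x => weakGrad Ω u x - gradient ψ x) - fun x => weakGrad Ω v x - gradient χ x := by
      filter_upwards [weakGrad_sub_ae_eq hΩ hu.1 hv.1] with x hx
      rw [hx, hψ.gradient_sub hχ, Pi.sub_apply, sub_sub_sub_comm]
    rw [eLpNorm_congr_ae hgrad]
    exact (eLpNorm_sub_le (hu.memLp_weakGrad.sub (hψ.memLp_gradient 2 _)).1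
      (hv.memLp_weakGrad.sub (hχ.memLp_gradient 2 _)).1
      one_le_two).trans_lt (ENNReal.add_lt_add hψg hχg)

end WeakGradient

/-! ### Translation estimates and Poincaré inequalities -/

lemma sq_lintegral_le {X : Type*} [MeasurableSpace X] {μ : Measure X} [IsProbabilityMeasure μ]
    {F : X → ENNReal} (hF : AEMeasurable F μ) : (∫⁻ x, F x ∂μ) ^ 2 ≤ ∫⁻ x, F x ^ 2 ∂μ := by
  have h := ENNReal.lintegral_mul_le_Lp_mul_Lq μ (Real.HolderConjugate.two_two) hF
    (g := fun _ => 1) aemeasurable_const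
  simp only [Pi.mul_apply, mul_one, ENNReal.one_rpow, lintegral_const, measure_univ] at h
  calc (∫⁻ x, F x ∂μ) ^ 2 ≤ ((∫⁻ x, F x ^ (2 : ℝ) ∂μ) ^ ((1 : ℝ) / 2)) ^ 2 := by gcongr
    _ = ∫⁻ x, F x ^ 2 ∂μ := by
      rw [← ENNReal.rpow_natCast, ← ENNReal.rpow_mul]
      norm_num

section Translation

lemma enorm_sub_sq_le_lintegral_fderiv {E F : Type*} [NormedAddCommGroup E]
    [NormedSpace ℝ E] [NormedAddCommGroup F] [NormedSpace ℝ F] [CompleteSpace F] {f : E → F}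
    (hf : ContDiff ℝ 1 f) (x h : E) :
    ‖f (x + h) - f x‖ₑ ^ 2
      ≤ ‖h‖ₑ ^ 2 * ∫⁻ t in Set.Ioc (0 : ℝ) 1, ‖fderiv ℝ f (x + t • h)‖ₑ ^ 2 := by
  have hcont : Continuous fun t : ℝ => fderiv ℝ f (x + t • h) :=
    (hf.continuous_fderiv one_ne_zero).comp (by fun_prop)
  have hderiv : ∀ t ∈ Set.uIcc (0 : ℝ) 1,
      HasDerivAt (fun t : ℝ => f (x + t • h)) (fderiv ℝ f (x + t • h) h) t := fun t _ =>
    (hf.differentiable one_ne_zero _).hasFDerivAt.comp_hasDerivAt t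
      (by simpa using ((hasDerivAt_id t).smul_const h).const_add x)
  have hftc : ∫ t in Set.Ioc (0 : ℝ) 1, fderiv ℝ f (x + t • h) h = f (x + h) - f x := by
    rw [← intervalIntegral.integral_of_le zero_le_one,
      intervalIntegral.integral_eq_sub_of_hasDerivAt hderiv
        ((hcont.clm_apply continuous_const).intervalIntegrable _ _)]
    simp
  have : IsProbabilityMeasure ((volume : Measure ℝ).restrict (Set.Ioc (0 : ℝ) 1)) := ⟨by simp⟩
  calc ‖f (x + h) - f x‖ₑ ^ 2
      ≤ (∫⁻ t in Set.Ioc (0 : ℝ) 1, ‖h‖ₑ * ‖fderiv ℝ f (x + t • h)‖ₑ) ^ 2 := by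
        rw [← hftc]
        gcongr
        refine (enorm_integral_le_lintegral_enorm _).trans (lintegral_mono fun t => ?_)
        rw [mul_comm]
        exact ContinuousLinearMap.le_opENorm _ _
    _ ≤ ∫⁻ t in Set.Ioc (0 : ℝ) 1, (‖h‖ₑ * ‖fderiv ℝ f (x + t • h)‖ₑ) ^ 2 :=
        sq_lintegral_le (hcont.enorm.measurable.const_mul _).aemeasurable
    _ = _ := by
        simp_rw [mul_pow]
        rw [lintegral_const_mul _ (hcont.enorm.measurable.pow_const 2)]

variable {E F : Type*} [NormedAddCommGroup E] [MeasurableSpace E] [BorelSpace E]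
  [NormedAddCommGroup F]

lemma eLpNorm_translate_sub_le_add {μ : Measure E} [μ.IsAddRightInvariant] {f g : E → F}
    (hf : AEStronglyMeasurable f μ) (hg : AEStronglyMeasurable g μ) (h : E) :
    eLpNorm (fun x => f (x + h) - f x) 2 μ
      ≤ 2 * eLpNorm (f - g) 2 μ + eLpNorm (fun x => g (x + h) - g x) 2 μ := by
  have hshift := measurePreserving_add_right μ h
  have hd := hf.sub hg
  have hd' := hd.comp_measurePreserving hshift
  have hsplit : (fun x => f (x + h) - f x)
      = ((f - g) ∘ (· + h) - (f - g)) + fun x => g (x + h) - g x := by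
    ext x
    simp only [Function.comp_apply, Pi.add_apply, Pi.sub_apply]
    abel
  calc eLpNorm (fun x => f (x + h) - f x) 2 μ
      ≤ eLpNorm ((f - g) ∘ (· + h) - (f - g)) 2 μ + eLpNorm (fun x => g (x + h) - g x) 2 μ := by
        rw [hsplit]
        exact eLpNorm_add_le (hd'.sub hd) ((hg.comp_measurePreserving hshift).sub hg) one_le_two
    _ ≤ _ := by
        gcongr
        refine (eLpNorm_sub_le hd' hd one_le_two).trans_eq ?_
        rw [eLpNorm_comp_measurePreserving hd hshift, two_mul]

lemma setLIntegral_le_setLIntegral_closedBall_add {μ : Measure E} [μ.IsAddLeftInvariant]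
    (g : E → ENNReal) {A : Set E} {y : E} {ρ : ℝ} (hA : A ⊆ Metric.closedBall y ρ) :
    ∫⁻ x in A, g x ∂μ ≤ ∫⁻ k in Metric.closedBall 0 ρ, g (y + k) ∂μ := by
  refine (lintegral_mono_set hA).trans_eq ?_
  rw [← (measurePreserving_add_left μ y).setLIntegral_comp_preimage_emb
    (measurableEmbedding_addLeft y)]
  simp

variable [NormedSpace ℝ E]

lemma eLpNorm_translate_sub_le_fderiv [NormedSpace ℝ F] [CompleteSpace F]
    (μ : Measure E) [μ.IsAddRightInvariant] [SFinite μ] {f : E → F}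
    (hf : ContDiff ℝ 1 f) (h : E) :
    eLpNorm (fun x => f (x + h) - f x) 2 μ ≤ ‖h‖ₑ * eLpNorm (fderiv ℝ f) 2 μ := by
  refine (ENNReal.pow_le_pow_left_iff two_ne_zero).1 ?_
  rw [mul_pow, eLpNorm_two_sq, eLpNorm_two_sq]
  have hm : Measurable fun z : E × ℝ => ‖fderiv ℝ f (z.1 + z.2 • h)‖ₑ ^ 2 :=
    (((hf.continuous_fderiv one_ne_zero).comp (by fun_prop : Continuous fun z : E × ℝ =>
      z.1 + z.2 • h)).enorm.measurable).pow_const 2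
  calc ∫⁻ x, ‖f (x + h) - f x‖ₑ ^ 2 ∂μ
      ≤ ∫⁻ x, ‖h‖ₑ ^ 2 * (∫⁻ t in Set.Ioc (0 : ℝ) 1, ‖fderiv ℝ f (x + t • h)‖ₑ ^ 2) ∂μ :=
        lintegral_mono fun x => enorm_sub_sq_le_lintegral_fderiv hf x h
    _ = ‖h‖ₑ ^ 2 * ∫⁻ t in Set.Ioc (0 : ℝ) 1, ∫⁻ x, ‖fderiv ℝ f (x + t • h)‖ₑ ^ 2 ∂μ := by
        rw [lintegral_const_mul _ hm.lintegral_prod_right',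
          lintegral_lintegral_swap hm.aemeasurable]
    _ = ‖h‖ₑ ^ 2 * ∫⁻ x, ‖fderiv ℝ f x‖ₑ ^ 2 ∂μ := by
        simp [lintegral_add_right_eq_self (fun x => ‖fderiv ℝ f x‖ₑ ^ 2)]

variable [FiniteDimensional ℝ E] {μ : Measure E} [μ.IsAddHaarMeasure]

lemma aemeasurable_enorm_translate_sub_sq {U : E → F} (hU : AEStronglyMeasurable U μ)
    (S : Set E) : AEMeasurable (fun z : E × E => ‖U (z.1 + z.2) - U z.1‖ₑ ^ 2)
      (μ.prod (μ.restrict S)) := by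
  have hadd : Measure.QuasiMeasurePreserving (fun z : E × E => z.1 + z.2) (μ.prod μ) μ :=
    Measure.quasiMeasurePreserving_snd.comp
      (measurePreserving_prod_add μ μ).quasiMeasurePreserving
  refine AEMeasurable.mono_ac ?_ (Measure.AbsolutelyContinuous.prod
    Measure.AbsolutelyContinuous.rfl Measure.restrict_le_self.absolutelyContinuous)
  exact ((hU.comp_quasiMeasurePreserving hadd).sub
    (hU.comp_quasiMeasurePreserving Measure.quasiMeasurePreserving_fst)).enorm.pow_const 2

lemma lintegral_lintegral_translate_sub_sq_le {U : E → F} (hU : AEStronglyMeasurable U μ)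
    {N : ENNReal} (htrans : ∀ k, eLpNorm (fun y => U (y + k) - U y) 2 μ ≤ ‖k‖ₑ * N) (ρ : ℝ) :
    ∫⁻ y, ∫⁻ k in Metric.closedBall (0 : E) ρ, ‖U (y + k) - U y‖ₑ ^ 2 ∂μ ∂μ
      ≤ (ENNReal.ofReal ρ * N) ^ 2 * μ (Metric.closedBall 0 ρ) := by
  rw [lintegral_lintegral_swap (aemeasurable_enorm_translate_sub_sq hU _), ← setLIntegral_const]
  refine setLIntegral_mono measurable_const fun k hk => ?_
  rw [← eLpNorm_two_sq]
  gcongr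
  refine (htrans k).trans ?_
  gcongr
  rw [← ofReal_norm]
  exact ENNReal.ofReal_le_ofReal (mem_closedBall_zero_iff.1 hk)

/-- The Poincaré inequality with the mean value replaced by the value at a point `y`: averaging the
translation estimate over `y ∈ Z` shows that some `y` does at least as well as the average. -/
lemma exists_eLpNorm_sub_sq_mul_measure_le {U : E → F} (hU : AEStronglyMeasurable U μ)
    {N : ENNReal} (htrans : ∀ k, eLpNorm (fun y => U (y + k) - U y) 2 μ ≤ ‖k‖ₑ * N)
    {A Z : Set E} (hZ₀ : μ Z ≠ 0) (hZ : μ Z ≠ ⊤) {ρ : ℝ}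
    (hAZ : ∀ y ∈ Z, A ⊆ Metric.closedBall y ρ) :
    ∃ y ∈ Z, eLpNorm (fun x => U x - U y) 2 (μ.restrict A) ^ 2 * μ Z
      ≤ (ENNReal.ofReal ρ * N) ^ 2 * μ (Metric.closedBall 0 ρ) := by
  obtain ⟨y, hyZ, hy⟩ := exists_le_setLAverage hZ₀ hZ
    (aemeasurable_enorm_translate_sub_sq hU (Metric.closedBall 0 ρ)).lintegral_prod_right'.restrict
  refine ⟨y, hyZ, ?_⟩
  rw [setLAverage_eq, ENNReal.le_div_iff_mul_le (Or.inl hZ₀) (Or.inl hZ)] at hy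
  calc eLpNorm (fun x => U x - U y) 2 (μ.restrict A) ^ 2 * μ Z
      ≤ (∫⁻ k in Metric.closedBall 0 ρ, ‖U (y + k) - U y‖ₑ ^ 2 ∂μ) * μ Z := by
        rw [eLpNorm_two_sq]
        exact mul_le_mul_left (setLIntegral_le_setLIntegral_closedBall_add _ (hAZ y hyZ)) _
    _ ≤ ∫⁻ y in Z, ∫⁻ k in Metric.closedBall 0 ρ, ‖U (y + k) - U y‖ₑ ^ 2 ∂μ ∂μ := hy
    _ ≤ _ := (setLIntegral_le_lintegral Z _).trans
        (lintegral_lintegral_translate_sub_sq_le hU htrans ρ)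

end Translation

section Poincare

variable {u : Plane → ℝ}

lemma MemH10.exists_eLpNorm_indicator_sub_lt (hΩ : MeasurableSet Ω) (hu : MemH10 Ω u)
    {δ : ENNReal} (hδ : 0 < δ) :
    ∃ ψ, IsTestFunction Ω ψ ∧ eLpNorm (Ω.indicator u - ψ) 2 volume < δ ∧
      eLpNorm (Ω.indicator (weakGrad Ω u) - gradient ψ) 2 volume < δ := by
  obtain ⟨ψ, hψ, hψu, hψg⟩ := hu.2 δ hδ
  refine ⟨ψ, hψ, ?_, ?_⟩
  · have hind : Ω.indicator u - ψ = Ω.indicator fun y => u y - ψ y := by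
      ext y
      by_cases hy : y ∈ Ω <;> simp [hy, hψ.eq_zero]
    rwa [hind, eLpNorm_indicator_eq_eLpNorm_restrict hΩ]
  · have hind : Ω.indicator (weakGrad Ω u) - gradient ψ
        = Ω.indicator fun y => weakGrad Ω u y - gradient ψ y := by
      ext1 y
      by_cases hy : y ∈ Ω <;> simp [hy, hψ.gradient_eq_zero]
    rwa [hind, eLpNorm_indicator_eq_eLpNorm_restrict hΩ]

lemma eLpNorm_gradient (ψ : Plane → ℝ) (p : ENNReal) (μ : Measure Plane) :
    eLpNorm (gradient ψ) p μ = eLpNorm (fderiv ℝ ψ) p μ :=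
  eLpNorm_congr_norm_ae (.of_forall fun _ => LinearIsometryEquiv.norm_map _ _)

lemma MemH10.eLpNorm_translate_sub_le (hΩ : IsOpen Ω) (hu : MemH10 Ω u) (h : Plane) :
    eLpNorm (fun y => Ω.indicator u (y + h) - Ω.indicator u y) 2 volume
      ≤ ‖h‖ₑ * eLpNorm (weakGrad Ω u) 2 (volume.restrict Ω) := by
  have hΩm := hΩ.measurableSet
  set N := eLpNorm (weakGrad Ω u) 2 (volume.restrict Ω)
  have hlim : Filter.Tendsto (fun δ : ENNReal => 2 * δ + ‖h‖ₑ * (N + δ))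
      (nhdsWithin 0 (Set.Ioi 0)) (nhds (2 * 0 + ‖h‖ₑ * (N + 0))) :=
    ((ENNReal.Tendsto.const_mul Filter.tendsto_id (Or.inr (by simp))).add
      (ENNReal.Tendsto.const_mul (tendsto_const_nhds.add Filter.tendsto_id)
        (Or.inr (by simp)))).mono_left nhdsWithin_le_nhds
  simp only [mul_zero, zero_add, add_zero] at hlim
  refine ge_of_tendsto hlim ?_
  filter_upwards [self_mem_nhdsWithin] with δ hδ
  obtain ⟨ψ, hψ, hψu, hψg⟩ := hu.exists_eLpNorm_indicator_sub_lt hΩm hδ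
  have hgrad : eLpNorm (gradient ψ) 2 volume ≤ N + δ := by
    have hG : AEStronglyMeasurable (Ω.indicator (weakGrad Ω u)) volume :=
      (aestronglyMeasurable_indicator_iff hΩm).2 hu.memLp_weakGrad.1
    have := eLpNorm_sub_le hG (hG.sub (hψ.memLp_gradient 2 _).1) (p := 2) one_le_two
    rw [sub_sub_cancel, eLpNorm_indicator_eq_eLpNorm_restrict hΩm] at this
    exact this.trans (by gcongr)
  refine (eLpNorm_translate_sub_le_add ((aestronglyMeasurable_indicator_iff hΩm).2 hu.memLp.1)
    (hψ.memLp 2 _).1 h).trans ?_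
  gcongr
  refine (eLpNorm_translate_sub_le_fderiv volume (hψ.1.of_le (by simp)) h).trans ?_
  rw [← eLpNorm_gradient]
  gcongr

lemma MemH10.l2norm_le_of_isBounded (hΩ : IsOpen Ω) (hb : Bornology.IsBounded Ω) :
    ∃ C : ℝ, 0 ≤ C ∧ ∀ u, MemH10 Ω u → l2norm Ω u ≤ C * l2norm Ω (weakGrad Ω u) := by
  obtain ⟨h, hh⟩ : ∃ h : Plane, ‖h‖ = Metric.diam Ω + 1 :=
    ((NormedSpace.sphere_nonempty (x := (0 : Plane))).2
      (by positivity [Metric.diam_nonneg (s := Ω)])).imp fun _ => mem_sphere_zero_iff_norm.1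
  refine ⟨‖h‖, norm_nonneg _, fun u hu => ?_⟩
  have hdisjoint : ∀ y ∈ Ω, y + h ∉ Ω := by
    intro y hy hy'
    have := Metric.dist_le_diam_of_mem hb hy' hy
    rw [dist_eq_norm, add_sub_cancel_left, hh] at this
    linarith
  have hle : eLpNorm u 2 (volume.restrict Ω)
      ≤ ‖h‖ₑ * eLpNorm (weakGrad Ω u) 2 (volume.restrict Ω) := by
    refine le_trans ?_ (hu.eLpNorm_translate_sub_le hΩ h)
    rw [← eLpNorm_indicator_eq_eLpNorm_restrict hΩ.measurableSet]
    refine eLpNorm_mono fun y => ?_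
    by_cases hy : y ∈ Ω <;> simp [hy, hdisjoint]
  simpa [l2norm] using
    ENNReal.toReal_mono (ENNReal.mul_ne_top (by simp) hu.memLp_weakGrad.2.ne) hle

lemma MemH10.exists_eLpNorm_indicator_sub_const_le (hΩ : IsOpen Ω) (hu : MemH10 Ω u)
    {x₀ y₀ : Plane} {R c : ℝ} (hR : 0 < R) (hc : 0 < c)
    (hsub : Metric.closedBall y₀ (c * R) ⊆ Metric.closedBall x₀ R) :
    ∃ y ∈ Metric.closedBall y₀ (c * R),
      eLpNorm (fun x => Ω.indicator u x - Ω.indicator u y) 2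
          (volume.restrict (Metric.closedBall x₀ R))
        ≤ ENNReal.ofReal (4 * R / c) * eLpNorm (weakGrad Ω u) 2 (volume.restrict Ω) := by
  have hZ₀ : volume (Metric.closedBall y₀ (c * R)) ≠ 0 :=
    (Metric.measure_closedBall_pos volume _ (by positivity)).ne'
  have hZ : volume (Metric.closedBall y₀ (c * R)) ≠ ⊤ := measure_closedBall_lt_top.ne
  obtain ⟨y, hy, hle⟩ := exists_eLpNorm_sub_sq_mul_measure_le
    ((aestronglyMeasurable_indicator_iff hΩ.measurableSet).2 hu.memLp.1)
    (hu.eLpNorm_translate_sub_le hΩ) hZ₀ hZ (A := Metric.closedBall x₀ R) (ρ := 2 * R)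
    fun y hy => Metric.closedBall_subset_closedBall' <| by
      rw [dist_comm]
      linarith [Metric.mem_closedBall.1 (hsub hy)]
  refine ⟨y, hy, (ENNReal.pow_le_pow_left_iff two_ne_zero).1 ?_⟩
  rw [← ENNReal.mul_le_mul_iff_left hZ₀ hZ]
  refine hle.trans_eq ?_
  have hconst : ENNReal.ofReal (2 * R) ^ 2 * ENNReal.ofReal ((2 * R) ^ 2)
      = ENNReal.ofReal (4 * R / c) ^ 2 * ENNReal.ofReal ((c * R) ^ 2) := by
    rw [← ENNReal.ofReal_pow (by positivity), ← ENNReal.ofReal_pow (by positivity),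
      ← ENNReal.ofReal_mul (by positivity), ← ENNReal.ofReal_mul (by positivity)]
    congr 1
    field_simp
    ring
  rw [Measure.addHaar_closedBall _ _ (by positivity),
    Measure.addHaar_closedBall _ _ (by positivity), finrank_euclideanSpace, Fintype.card_fin]
  generalize eLpNorm (weakGrad Ω u) 2 (volume.restrict Ω) = N
  calc (ENNReal.ofReal (2 * R) * N) ^ 2
        * (ENNReal.ofReal ((2 * R) ^ 2) * volume (Metric.ball (0 : Plane) 1))
      = ENNReal.ofReal (2 * R) ^ 2 * ENNReal.ofReal ((2 * R) ^ 2)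
        * (N ^ 2 * volume (Metric.ball (0 : Plane) 1)) := by ring
    _ = _ := by rw [hconst]; ring

end Poincare

/-! ### Exterior balls of Lipschitz domains -/

/-- The exterior corkscrew condition for `Ω` at the points of `S`, with constant `c` and up to the
scale `D`: every ball of radius `R ≤ D` centred in `S` contains a ball of radius `c * R` that
misses `Ω`. -/
def HasExteriorCorkscrew {X : Type*} [PseudoMetricSpace X] (Ω S : Set X) (c D : ℝ) : Prop :=
  ∀ z ∈ S, ∀ R, 0 < R → R ≤ D →
    ∃ y, Metric.closedBall y (c * R) ⊆ Metric.closedBall z R ∩ Ωᶜ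

namespace HasExteriorCorkscrew

variable {X : Type*} [PseudoMetricSpace X] {Ω S S' : Set X} {c c' r D : ℝ}

lemma mono (h : HasExteriorCorkscrew Ω S c D) (hS : S' ⊆ S) (hc : c' ≤ c) :
    HasExteriorCorkscrew Ω S' c' D := fun z hz R hR hRD =>
  (h z (hS hz) R hR hRD).imp fun _ hy =>
    (Metric.closedBall_subset_closedBall (by gcongr)).trans hy

lemma union (h : HasExteriorCorkscrew Ω S c D) (h' : HasExteriorCorkscrew Ω S' c D) :
    HasExteriorCorkscrew Ω (S ∪ S') c D := fun z hz =>
  hz.elim (h z) (h' z)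

lemma enlarge_scale (h : HasExteriorCorkscrew Ω S c r) (hc : 0 < c) (hr : 0 < r) (hD : 0 < D) :
    HasExteriorCorkscrew Ω S (c * min 1 (r / D)) D := by
  intro z hz R hR hRD
  obtain ⟨y, hy⟩ := h z hz (min R r) (lt_min hR hr) (min_le_right _ _)
  have hradius : c * min 1 (r / D) * R ≤ c * min R r := by
    rw [mul_assoc, min_mul_of_nonneg _ _ hR.le, one_mul]
    gcongr
    rw [div_mul_eq_mul_div, div_le_iff₀ hD]
    gcongr
  exact ⟨y, (Metric.closedBall_subset_closedBall hradius).trans <| hy.trans <|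
    Set.inter_subset_inter_left _ (Metric.closedBall_subset_closedBall (min_le_left _ _))⟩

end HasExteriorCorkscrew

lemma abs_coord_le_norm (x : Plane) (i : Fin 2) : |x i| ≤ ‖x‖ := by
  simpa using PiLp.norm_apply_le x i

lemma coord_le_of_mem_closedBall_sub_single {K : NNReal} {ψ : ℝ → ℝ} (hψ : LipschitzWith K ψ)
    {z y : Plane} (hz : z 1 ≤ ψ (z 0)) {ρ : ℝ}
    (hy : y ∈ Metric.closedBall (z - EuclideanSpace.single 1 (ρ / 2)) (1 / (4 * (K + 1)) * ρ)) :
    y 1 ≤ ψ (y 0) := by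
  set δ : ℝ := 1 / (4 * (K + 1)) * ρ with hδ
  have hδK : (K + 1) * δ = ρ / 4 := by
    rw [hδ]
    field_simp
  have hδ₀ : 0 ≤ δ := dist_nonneg.trans hy
  rw [Metric.mem_closedBall, dist_eq_norm] at hy
  have hy₀ : |y 0 - z 0| ≤ δ := by simpa using (abs_coord_le_norm _ 0).trans hy
  have hy₁ : |y 1 - z 1 + ρ / 2| ≤ δ := by simpa [sub_add] using (abs_coord_le_norm _ 1).trans hy
  have hψzy : ψ (z 0) - ψ (y 0) ≤ K * δ := by
    refine (le_abs_self _).trans ((hψ.dist_le_mul (z 0) (y 0)).trans ?_)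
    rw [dist_comm]
    exact mul_le_mul_of_nonneg_left hy₀ K.2
  nlinarith [(abs_le.1 hy₁).2]

lemma HasLipschitzBoundary.exists_hasExteriorCorkscrew_ball (hL : HasLipschitzBoundary Ω)
    (hΩ : IsOpen Ω) {x : Plane} (hx : x ∈ frontier Ω) :
    ∃ c r : ℝ, 0 < c ∧ 0 < r ∧ HasExteriorCorkscrew Ω (frontier Ω ∩ Metric.ball x r) c r := by
  obtain ⟨r, hr, e, K, ψ, hψ, he⟩ := hL x hx
  refine ⟨1 / (4 * (K + 1)), r / 2, by positivity, by positivity, ?_⟩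
  rintro z ⟨hz, hzx⟩ ρ hρ hρr
  have hzΩ : e z 1 ≤ ψ (e z 0) := by
    rw [hΩ.frontier_eq] at hz
    exact not_lt.1 (mt (he z (Metric.ball_subset_ball (by linarith) hzx)).2 hz.2)
  set w : Plane := e z - EuclideanSpace.single 1 (ρ / 2) with hw
  have hwz : dist (e.symm w) z = ρ / 2 := by
    rw [← e.dist_map, e.apply_symm_apply, hw, dist_eq_norm, sub_sub_cancel_left, norm_neg,
      PiLp.norm_single, Real.norm_of_nonneg (by positivity)]
  have hradius : 1 / (4 * ((K : ℝ) + 1)) * ρ ≤ ρ / 2 := by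
    rw [div_mul_eq_mul_div, one_mul]
    exact div_le_div_of_nonneg_left hρ.le two_pos (by linarith [K.2])
  have hsub : Metric.closedBall (e.symm w) (1 / (4 * (K + 1)) * ρ) ⊆ Metric.closedBall z ρ :=
    Metric.closedBall_subset_closedBall' (by linarith)
  refine ⟨e.symm w, fun y hy => ⟨hsub hy, fun hyΩ => ?_⟩⟩
  have hyx : y ∈ Metric.ball x r := by
    have hyz := Metric.mem_closedBall.1 (hsub hy)
    rw [Metric.mem_ball] at hzx ⊢
    linarith [dist_triangle y z x]
  refine ((he y hyx).1 hyΩ).not_ge (coord_le_of_mem_closedBall_sub_single hψ hzΩ (ρ := ρ) ?_)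
  rwa [Metric.mem_closedBall, ← e.symm.dist_map, e.symm_apply_apply]

lemma HasLipschitzBoundary.exists_hasExteriorCorkscrew_frontier (hL : HasLipschitzBoundary Ω)
    (hΩ : IsOpen Ω) (hb : Bornology.IsBounded Ω) {D : ℝ} (hD : 0 < D) :
    ∃ c : ℝ, 0 < c ∧ HasExteriorCorkscrew Ω (frontier Ω) c D := by
  have hcompact : IsCompact (frontier Ω) :=
    Metric.isCompact_of_isClosed_isBounded isClosed_frontier
      (hb.closure.subset frontier_subset_closure)
  refine hcompact.induction_on ⟨1, one_pos, fun z hz => hz.elim⟩ ?_ ?_ fun x hx => ?_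
  · rintro S S' hS ⟨c, hc, h⟩
    exact ⟨c, hc, h.mono hS le_rfl⟩
  · rintro S S' ⟨c, hc, h⟩ ⟨c', hc', h'⟩
    exact ⟨min c c', lt_min hc hc',
      (h.mono subset_rfl (min_le_left _ _)).union (h'.mono subset_rfl (min_le_right _ _))⟩
  · obtain ⟨c, r, hc, hr, h⟩ := hL.exists_hasExteriorCorkscrew_ball hΩ hx
    exact ⟨_, inter_mem_nhdsWithin _ (Metric.ball_mem_nhds x hr), _,
      mul_pos hc (lt_min one_pos (div_pos hr hD)), h.enlarge_scale hc hr hD⟩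

/-! ### Piecewise Lipschitz functions -/

section PiecewiseLipschitz

variable {X ι : Type*} [PseudoMetricSpace X] [Finite ι] {K : NNReal}

lemma exists_frequently_mem_of_iUnion_eq_univ {Y : Type*} {l : Filter Y} [l.NeBot]
    {S : ι → Set Y} (hcov : ⋃ i, S i = Set.univ) : ∃ i, ∃ᶠ s in l, s ∈ S i := by
  by_contra! hcon
  obtain ⟨s, hs⟩ := (Filter.eventually_all.2 hcon).exists
  obtain ⟨i, hi⟩ := Set.mem_iUnion.1 (hcov ▸ Set.mem_univ s)
  exact hs i hi

lemma dist_le_mul_sub_of_closed_cover {F : ℝ → X} {S : ι → Set ℝ} (hS : ∀ i, IsClosed (S i))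
    (hcov : ⋃ i, S i = Set.univ) (hF : ∀ i, LipschitzOnWith K F (S i)) {a b : ℝ} (hab : a ≤ b) :
    dist (F b) (F a) ≤ K * (b - a) := by
  have hcont : Continuous F :=
    (locallyFinite_of_finite S).continuous hcov hS fun i => (hF i).continuousOn
  have hclosed : IsClosed {t : ℝ | dist (F t) (F a) ≤ K * (t - a)} :=
    isClosed_le (by fun_prop) (by fun_prop)
  refine (hclosed.inter isClosed_Icc).Icc_subset_of_forall_exists_gt (a := a) (b := b)
    (by simp) ?_ (Set.right_mem_Icc.2 hab)
  rintro t ⟨ht : dist (F t) (F a) ≤ K * (t - a), -⟩ y hy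
  obtain ⟨i, hi⟩ := exists_frequently_mem_of_iUnion_eq_univ (l := nhdsWithin t (Set.Ioi t)) hcov
  have hti : t ∈ S i := by
    rw [← (hS i).closure_eq, mem_closure_iff_frequently]
    exact hi.filter_mono nhdsWithin_le_nhds
  obtain ⟨s, hs, hts⟩ := (hi.and_eventually (Ioc_mem_nhdsGT hy)).exists
  have hst := (hF i).dist_le_mul s hs t hti
  rw [Real.dist_eq, abs_of_pos (sub_pos.2 hts.1)] at hst
  refine ⟨s, ?_, hts⟩
  rw [Set.mem_ofPred_eq]
  linarith [dist_triangle (F s) (F t) (F a)]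

lemma lipschitzWith_of_closed_cover {E : Type*} [NormedAddCommGroup E] [NormedSpace ℝ E]
    {F : E → X} {S : ι → Set E} (hS : ∀ i, IsClosed (S i)) (hcov : ⋃ i, S i = Set.univ)
    (hF : ∀ i, LipschitzOnWith K F (S i)) : LipschitzWith K F := by
  refine LipschitzWith.of_dist_le_mul fun x y => ?_
  have hline : LipschitzWith (nndist x y) (AffineMap.lineMap y x : ℝ → E) :=
    LipschitzWith.of_dist_le_mul fun s t => by
      rw [dist_lineMap_lineMap, mul_comm, dist_comm y x, coe_nndist]
  have := dist_le_mul_sub_of_closed_cover (F := F ∘ AffineMap.lineMap y x)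
    (S := fun i => AffineMap.lineMap y x ⁻¹' S i) (fun i => (hS i).preimage hline.continuous)
    (by rw [← Set.preimage_iUnion, hcov, Set.preimage_univ])
    (fun i => (hF i).comp (hline.lipschitzOnWith (s := _)) (Set.mapsTo_preimage _ _))
    zero_le_one
  simpa using this

end PiecewiseLipschitz

/-! ### Triangulations as measurable decompositions -/

lemma addHaar_convexHull_eq_zero {E : Type*} [NormedAddCommGroup E] [NormedSpace ℝ E]
    [MeasurableSpace E] [BorelSpace E] [FiniteDimensional ℝ E] (μ : Measure E)
    [μ.IsAddHaarMeasure] {s : Finset E} (hs : s.card ≤ Module.finrank ℝ E) :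
    μ (convexHull ℝ (s : Set E)) = 0 := by
  classical
  refine measure_mono_null (convexHull_subset_affineSpan _)
    (Measure.addHaar_affineSubspace μ _ fun htop => ?_)
  have hne : s.Nonempty := by
    rw [← Finset.coe_nonempty, ← affineSpan_nonempty ℝ, htop]
    exact ⟨0, trivial⟩
  have hrank := finrank_vectorSpan_image_finset_le ℝ (id : E → E) s (n := s.card - 1)
    (Nat.sub_add_cancel hne.card_pos).symm
  rw [Finset.image_id, ← direction_affineSpan, htop, AffineSubspace.direction_top,
    finrank_top] at hrank
  have := hne.card_pos
  omega

lemma IsPolygonalDomain.volume_frontier (hΩ : IsPolygonalDomain Ω) : volume (frontier Ω) = 0 := by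
  classical
  obtain ⟨S, hS⟩ := hΩ.polygonal
  rw [hS]
  refine (measure_biUnion_null_iff S.countable_toSet).2 fun s _ => ?_
  rw [← convexHull_pair, ← Finset.coe_pair]
  exact addHaar_convexHull_eq_zero volume (by simpa using Finset.card_le_two)

lemma isFiniteMeasure_restrict_of_isBounded (hb : Bornology.IsBounded Ω) :
    IsFiniteMeasure ((volume : Measure Plane).restrict Ω) :=
  isFiniteMeasure_restrict.2 hb.measure_lt_top.ne

lemma isCompact_tri (t : Finset Plane) : IsCompact (tri t) :=
  t.finite_toSet.isCompact_convexHull ℝ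

lemma isClosed_tri (t : Finset Plane) : IsClosed (tri t) := (isCompact_tri t).isClosed

lemma convex_tri (t : Finset Plane) : Convex ℝ (tri t) := convex_convexHull ℝ _

lemma mem_tri {t : Finset Plane} {z : Plane} (hz : z ∈ t) : z ∈ tri t :=
  subset_convexHull ℝ _ hz

lemma dist_le_cellDiam {t : Finset Plane} {x y : Plane} (hx : x ∈ tri t) (hy : y ∈ tri t) :
    dist x y ≤ cellDiam t :=
  Metric.dist_le_diam_of_mem (isCompact_tri t).isBounded hx hy

namespace Triangulation

lemma iUnion_tri (T : Triangulation Ω) : ⋃ t : T.cells, tri t = closure Ω := by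
  rw [← T.cover, Set.iUnion_subtype]
  rfl

lemma tri_subset (T : Triangulation Ω) {t : Finset Plane} (ht : t ∈ T.cells) :
    tri t ⊆ closure Ω := by
  rw [← T.cover]
  exact Set.subset_biUnion_of_mem (u := fun t : Finset Plane => convexHull ℝ (t : Set Plane)) ht

lemma exists_mem_tri (T : Triangulation Ω) {x : Plane} (hx : x ∈ closure Ω) :
    ∃ t ∈ T.cells, x ∈ tri t := by
  rw [← T.cover] at hx
  simpa [tri] using hx

lemma ae_exists_mem_interior (T : Triangulation Ω) (hΩ : MeasurableSet Ω) :
    ∀ᵐ x ∂(volume : Measure Plane).restrict Ω, ∃ t ∈ T.cells, x ∈ interior (tri t) := by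
  have hfrontier : ∀ᵐ x ∂(volume : Measure Plane), ∀ t ∈ T.cells, x ∉ frontier (tri t) :=
    (Finset.eventually_all _).2 fun t _ =>
      measure_eq_zero_iff_ae_notMem.1 ((convex_tri t).addHaar_frontier volume)
  rw [ae_restrict_iff' hΩ]
  filter_upwards [hfrontier] with x hx hxΩ
  obtain ⟨t, ht, hxt⟩ := T.exists_mem_tri (subset_closure hxΩ)
  exact ⟨t, ht, by_contra fun hxi => hx t ht ⟨subset_closure hxt, hxi⟩⟩

lemma volume_tri_inter (T : Triangulation Ω) {s t : Finset Plane} (hs : s ∈ T.cells)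
    (ht : t ∈ T.cells) (hst : s ≠ t) : volume (tri s ∩ tri t) = 0 := by
  classical
  have hssub : s ∩ t ⊂ s := by
    refine Finset.inter_subset_left.ssubset_of_ne fun h => hst ?_
    exact Finset.eq_of_subset_of_card_le (Finset.inter_eq_left.1 h)
      (by rw [T.card_eq s hs, T.card_eq t ht])
  have hcard := Finset.card_lt_card hssub
  rw [T.card_eq s hs] at hcard
  rw [tri, tri, T.inter s hs t ht, ← Finset.coe_inter]
  exact addHaar_convexHull_eq_zero volume (by simpa using Nat.le_of_lt_succ hcard)

variable (hΩ : volume (frontier Ω) = 0)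
include hΩ

lemma restrict_eq_sum (T : Triangulation Ω) :
    (volume : Measure Plane).restrict Ω = ∑ t ∈ T.cells, volume.restrict (tri t) := by
  rw [← Measure.restrict_congr_set (closure_ae_eq_of_null_frontier hΩ), ← T.iUnion_tri,
    Measure.restrict_iUnion_ae, Measure.sum_fintype]
  · exact Finset.sum_coe_sort T.cells fun t => (volume : Measure Plane).restrict (tri t)
  · exact fun s t hst => T.volume_tri_inter s.2 t.2 (Subtype.coe_ne_coe.2 hst)
  · exact fun t => (isClosed_tri _).measurableSet.nullMeasurableSet

lemma restrict_tri_le (T : Triangulation Ω) {t : Finset Plane} (ht : t ∈ T.cells) :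
    (volume : Measure Plane).restrict (tri t) ≤ volume.restrict Ω := by
  rw [← Measure.restrict_congr_set (closure_ae_eq_of_null_frontier hΩ)]
  exact Measure.restrict_mono_set _ (T.tri_subset ht)

lemma integral_eq_sum (T : Triangulation Ω) {V : Type*} [NormedAddCommGroup V] [NormedSpace ℝ V]
    {F : Plane → V} (hF : Integrable F (volume.restrict Ω)) :
    ∫ x in Ω, F x = ∑ t ∈ T.cells, ∫ x in tri t, F x := by
  rw [T.restrict_eq_sum hΩ, integral_finsetSum_measure]
  exact fun t ht => hF.mono_measure (T.restrict_tri_le hΩ ht)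

end Triangulation

/-! ### Lipschitz functions in `H¹₀` -/

lemma tendsto_eLpNorm_zero_of_bounded {X V : Type*} [MeasurableSpace X] [NormedAddCommGroup V]
    {μ : Measure X} [IsFiniteMeasure μ] {p : ENNReal} (hp0 : p ≠ 0) (hp : p ≠ ⊤)
    {F : ℕ → X → V} (C : ℝ) (hm : ∀ m, AEStronglyMeasurable (F m) μ)
    (hC : ∀ m, ∀ᵐ x ∂μ, ‖F m x‖ ≤ C)
    (hlim : ∀ᵐ x ∂μ, Filter.Tendsto (fun m => F m x) Filter.atTop (nhds 0)) :
    Filter.Tendsto (fun m => eLpNorm (F m) p μ) Filter.atTop (nhds 0) := by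
  have hp' : 0 < p.toReal := ENNReal.toReal_pos hp0 hp
  have hpow : ∀ {q : ℝ}, 0 < q → Filter.Tendsto (fun a : ENNReal => a ^ q) (nhds 0) (nhds 0) := by
    intro q hq
    simpa [hq] using (ENNReal.continuous_rpow_const (y := q)).tendsto 0
  have hint : Filter.Tendsto (fun m => ∫⁻ x, ‖F m x‖ₑ ^ p.toReal ∂μ) Filter.atTop
      (nhds (∫⁻ _, 0 ∂μ)) := by
    refine tendsto_lintegral_of_dominated_convergence' (fun _ => ENNReal.ofReal C ^ p.toReal)
      (fun m => (hm m).enorm.pow_const _) (fun m => ?_) ?_ ?_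
    · filter_upwards [hC m] with x hx
      gcongr
      rw [← ofReal_norm]
      exact ENNReal.ofReal_le_ofReal hx
    · rw [lintegral_const]
      exact ENNReal.mul_ne_top (ENNReal.rpow_ne_top_of_nonneg hp'.le ENNReal.ofReal_ne_top)
        (measure_ne_top _ _)
    · filter_upwards [hlim] with x hx
      exact (hpow hp').comp (by simpa using hx.enorm)
  simp_rw [eLpNorm_eq_lintegral_rpow_enorm_toReal hp0 hp]
  rw [lintegral_zero] at hint
  exact (hpow (one_div_pos.2 hp')).comp hint

section LipschitzCalculus

open scoped Convolution

variable {E : Type*} [NormedAddCommGroup E] [NormedSpace ℝ E] [FiniteDimensional ℝ E]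
  [MeasurableSpace E] [BorelSpace E] {μ : Measure E} [μ.IsAddHaarMeasure] {v : E → ℝ} {K : NNReal}

lemma ae_fderiv_eq_zero_of_eq_zero (hv : LipschitzWith K v) :
    ∀ᵐ x ∂μ, v x = 0 → fderiv ℝ v x = 0 := by
  filter_upwards [(lipschitzWith_one_norm.comp hv).ae_differentiableAt] with x hd hx
  have hmin : IsLocalMin (norm ∘ v) x :=
    Filter.Eventually.of_forall fun y => by simp [hx]
  have hnorm := hd.hasFDerivAt
  rw [hmin.fderiv_eq_zero, hasFDerivAt_iff_isLittleO] at hnorm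
  refine HasFDerivAt.fderiv (hasFDerivAt_iff_isLittleO.2 ?_)
  simpa [hx] using hnorm

lemma integral_lineDeriv_eq_zero (hv : LipschitzWith K v) (hc : HasCompactSupport v) (y : E) :
    ∫ x, lineDeriv ℝ v x y ∂μ = 0 := by
  simpa [lineDeriv] using
    (LipschitzWith.integral_lineDeriv_mul_eq (μ := μ) (LipschitzWith.const (1 : ℝ)) hv hc (-y)).symm

variable (φ : ContDiffBump (0 : E))

lemma abs_normed_convolution_sub_le (hv : LipschitzWith K v) (x : E) :
    |(φ.normed μ ⋆[ContinuousLinearMap.lsmul ℝ ℝ, μ] v) x - v x| ≤ K * φ.rOut := by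
  rw [← Real.dist_eq]
  refine φ.dist_normed_convolution_le hv.continuous.aestronglyMeasurable fun y hy => ?_
  exact (hv.dist_le_mul y x).trans (by gcongr; exact (Metric.mem_ball.1 hy).le)

lemma norm_normed_convolution_le {V : Type*} [NormedAddCommGroup V] [NormedSpace ℝ V]
    [CompleteSpace V] {G : E → V} {C : ℝ} (hm : AEStronglyMeasurable G μ) (hG : ∀ x, ‖G x‖ ≤ C)
    (x : E) : ‖(φ.normed μ ⋆[ContinuousLinearMap.lsmul ℝ ℝ, μ] G) x‖ ≤ C := by
  rw [← dist_zero_right]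
  exact dist_convolution_le ((norm_nonneg _).trans (hG x)) φ.support_normed_eq.subset
    φ.nonneg_normed φ.integral_normed hm fun y _ => by simpa using hG y

lemma hasFDerivAt_normed_convolution (hv : LipschitzWith K v) (x : E) :
    HasFDerivAt (φ.normed μ ⋆[ContinuousLinearMap.lsmul ℝ ℝ, μ] v)
      ((φ.normed μ ⋆[ContinuousLinearMap.lsmul ℝ ℝ, μ] fderiv ℝ v) x) x := by
  have hφ : Continuous (φ.normed μ) := φ.continuous_normed
  have hdiff : ∀ᵐ t ∂μ, DifferentiableAt ℝ v (x - t) :=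
    (Measure.measurePreserving_sub_left μ x).quasiMeasurePreserving.ae hv.ae_differentiableAt
  refine (hasFDerivAt_integral_of_dominated_loc_of_lip
    (F := fun y t => φ.normed μ t • v (y - t)) (F' := fun t => φ.normed μ t • fderiv ℝ v (x - t))
    (bound := fun t => φ.normed μ t * K) Filter.univ_mem ?_ ?_ ?_ ?_ ?_ ?_).2
  · have := hv.continuous
    exact Filter.Eventually.of_forall fun y => by fun_prop
  · have := hv.continuous
    exact Continuous.integrable_of_hasCompactSupport (by fun_prop)
      φ.hasCompactSupport_normed.smul_right
  · exact hφ.aestronglyMeasurable.smul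
      ((measurable_fderiv ℝ v).comp (measurable_const.sub measurable_id)).aestronglyMeasurable
  · refine Filter.Eventually.of_forall fun t => LipschitzOnWith.of_dist_le_mul fun y _ z _ => ?_
    have hvt := hv.dist_le_mul (y - t) (z - t)
    have h0 := φ.nonneg_normed (μ := μ) t
    rw [dist_sub_right] at hvt
    rw [dist_smul₀, Real.norm_of_nonneg h0, Real.coe_nnabs, abs_of_nonneg (by positivity),
      mul_assoc]
    gcongr
  · exact φ.integrable_normed.mul_const _
  · filter_upwards [hdiff] with t ht
    exact ((hasFDerivAt_comp_sub t).2 ht.hasFDerivAt).const_smul (φ.normed μ t)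

end LipschitzCalculus

section LipschitzSobolev

open scoped Convolution

variable {v : Plane → ℝ} {K : NNReal}

lemma measurable_gradient (u : Plane → ℝ) : Measurable (gradient u) :=
  (LinearIsometryEquiv.continuous _).measurable.comp (measurable_fderiv ℝ u)

lemma norm_gradient (u : Plane → ℝ) (x : Plane) : ‖gradient u x‖ = ‖fderiv ℝ u x‖ :=
  LinearIsometryEquiv.norm_map _ _

lemma contDiff_normed_convolution (φ : ContDiffBump (0 : Plane)) (hv : Continuous v) :
    ContDiff ℝ ∞ (φ.normed volume ⋆[ContinuousLinearMap.lsmul ℝ ℝ, volume] v) :=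
  φ.hasCompactSupport_normed.contDiff_convolution_left _ φ.contDiff_normed hv.locallyIntegrable

lemma isTestFunction_normed_convolution (φ : ContDiffBump (0 : Plane)) (hv : Continuous v)
    (hc : HasCompactSupport v) (hs : Metric.cthickening φ.rOut (tsupport v) ⊆ Ω) :
    IsTestFunction Ω (φ.normed volume ⋆[ContinuousLinearMap.lsmul ℝ ℝ, volume] v) := by
  refine ⟨contDiff_normed_convolution φ hv, φ.hasCompactSupport_normed.convolution _ hc, ?_⟩
  refine (closure_minimal ?_ Metric.isClosed_cthickening).trans hs
  refine (support_convolution_subset _).trans ?_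
  rintro _ ⟨t, ht, y, hy, rfl⟩
  rw [φ.support_normed_eq, mem_ball_zero_iff] at ht
  exact Metric.mem_cthickening_of_dist_le _ y _ _ (subset_tsupport v hy) (by simpa using ht.le)

variable {φ : ℕ → ContDiffBump (0 : Plane)}
  (hφ : Filter.Tendsto (fun m => (φ m).rOut) Filter.atTop (nhds 0))
include hφ

lemma tendsto_eLpNorm_sub_normed_convolution (hv : LipschitzWith K v) (μ : Measure Plane)
    [IsFiniteMeasure μ] :
    Filter.Tendsto (fun m => eLpNorm (fun x => v x -
      ((φ m).normed volume ⋆[ContinuousLinearMap.lsmul ℝ ℝ, volume] v) x) 2 μ)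
      Filter.atTop (nhds 0) := by
  have hdist : ∀ m x, ‖v x - ((φ m).normed volume ⋆[ContinuousLinearMap.lsmul ℝ ℝ, volume] v) x‖
      ≤ K * (φ m).rOut := fun m x => by
    rw [norm_sub_rev]
    exact abs_normed_convolution_sub_le (φ m) hv x
  obtain ⟨R, hR⟩ := hφ.bddAbove_range
  refine tendsto_eLpNorm_zero_of_bounded two_ne_zero ENNReal.ofNat_ne_top (K * R) (fun m => ?_)
    (fun m => ae_of_all _ fun x => (hdist m x).trans ?_) (ae_of_all _ fun x => ?_)
  · exact (hv.continuous.sub (contDiff_normed_convolution (φ m) hv.continuous).continuous)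
      |>.aestronglyMeasurable
  · gcongr
    exact hR ⟨m, rfl⟩
  · exact squeeze_zero_norm (fun m => hdist m x) (by simpa using hφ.const_mul (K : ℝ))

lemma tendsto_eLpNorm_gradient_sub_normed_convolution (hv : LipschitzWith K v) {C : ℝ}
    (hC : ∀ m, (φ m).rOut ≤ C * (φ m).rIn) [IsFiniteMeasure (volume.restrict Ω)] :
    Filter.Tendsto (fun m => eLpNorm (fun x => gradient v x - gradient
      ((φ m).normed volume ⋆[ContinuousLinearMap.lsmul ℝ ℝ, volume] v) x) 2 (volume.restrict Ω))
      Filter.atTop (nhds 0) := by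
  have hfderiv : ∀ m x, fderiv ℝ ((φ m).normed volume ⋆[ContinuousLinearMap.lsmul ℝ ℝ, volume] v) x
      = _ := fun m x => (hasFDerivAt_normed_convolution (φ m) hv x).fderiv
  have hbound : ∀ x, ‖fderiv ℝ v x‖ ≤ K := fun x => norm_fderiv_le_of_lipschitz ℝ hv
  have hmeas := (measurable_fderiv ℝ v).aestronglyMeasurable (μ := volume)
  have hloc : LocallyIntegrable (fderiv ℝ v) volume :=
    (memLp_top_of_bound hmeas K (ae_of_all _ hbound)).locallyIntegrable le_top
  refine tendsto_eLpNorm_zero_of_bounded two_ne_zero ENNReal.ofNat_ne_top (K + K)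
    (fun m => ((measurable_gradient _).sub (measurable_gradient _)).aestronglyMeasurable)
    (fun m => ae_of_all _ fun x => (norm_sub_le _ _).trans (add_le_add ?_ ?_)) ?_
  · exact (norm_gradient v x).trans_le (hbound x)
  · rw [norm_gradient, hfderiv]
    exact norm_normed_convolution_le _ hmeas hbound x
  · filter_upwards [ae_restrict_of_ae
      (ContDiffBump.ae_convolution_tendsto_right_of_locallyIntegrable hφ (.of_forall hC) hloc)]
      with x hx
    have hsub := ((InnerProductSpace.toDual ℝ Plane).symm.continuous.tendsto _).comp
      (hx.const_sub (fderiv ℝ v x))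
    simpa [gradient, hfderiv, Function.comp_def] using hsub

omit hφ

lemma exists_isTestFunction_eLpNorm_lt (hΩ : IsOpen Ω) (hb : Bornology.IsBounded Ω)
    (hv : LipschitzWith K v) (hc : HasCompactSupport v) (hs : tsupport v ⊆ Ω) {δ : ENNReal}
    (hδ : 0 < δ) : ∃ ψ, IsTestFunction Ω ψ ∧
      eLpNorm (fun x => v x - ψ x) 2 (volume.restrict Ω) < δ ∧
      eLpNorm (fun x => gradient v x - gradient ψ x) 2 (volume.restrict Ω) < δ := by
  have := isFiniteMeasure_restrict_of_isBounded hb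
  obtain ⟨r, hr, hrΩ⟩ := hc.isCompact.exists_cthickening_subset_open hΩ hs
  let φ : ℕ → ContDiffBump (0 : Plane) := fun m =>
    ⟨r / ((m : ℝ) + 1) / 2, r / ((m : ℝ) + 1), by positivity, half_lt_self (by positivity)⟩
  have hφr : ∀ m, (φ m).rOut ≤ r := fun m => div_le_self hr.le (by simp)
  have hφ : Filter.Tendsto (fun m => (φ m).rOut) Filter.atTop (nhds 0) := by
    simpa [φ, div_eq_mul_inv] using tendsto_one_div_add_atTop_nhds_zero_nat.const_mul r
  obtain ⟨m, hvalue, hgradient⟩ :=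
    (((tendsto_eLpNorm_sub_normed_convolution hφ hv (volume.restrict Ω)).eventually_lt_const
      hδ).and ((tendsto_eLpNorm_gradient_sub_normed_convolution (Ω := Ω) hφ hv (C := 2)
        fun m => (mul_div_cancel₀ _ two_ne_zero).ge).eventually_lt_const hδ)).exists
  exact ⟨_, isTestFunction_normed_convolution (φ m) hv.continuous hc
    ((Metric.cthickening_mono (hφr m) _).trans hrΩ), hvalue, hgradient⟩

end LipschitzSobolev

section LipschitzH10

variable {u v : Plane → ℝ} {K L : NNReal}

lemma hasWeakGrad_gradient_of_lipschitzWith_mul (hu : MemLp u 2 (volume.restrict Ω))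
    (hgrad : MemLp (gradient u) 2 (volume.restrict Ω))
    (hdiff : ∀ᵐ x ∂(volume : Measure Plane).restrict Ω, DifferentiableAt ℝ u x)
    (hmul : ∀ ψ, IsTestFunction Ω ψ → ∃ K, LipschitzWith K fun x => u x * ψ x) :
    HasWeakGrad Ω u (gradient u) := by
  refine ⟨hu, hgrad, fun ψ hψ y => ?_⟩
  obtain ⟨K, hK⟩ := hmul ψ hψ
  have hzero := integral_lineDeriv_eq_zero (μ := volume) hK hψ.2.1.mul_left y
  have hsupp : ∀ x ∉ Ω, lineDeriv ℝ (fun x => u x * ψ x) x y = 0 := fun x hx => by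
    have hev : (fun x => u x * ψ x) =ᶠ[nhds x] 0 := notMem_tsupport_iff_eventuallyEq.1
      fun h => hx (hψ.2.2 (closure_mono (Function.support_mul_subset_right u ψ) h))
    rw [hev.lineDeriv_eq]
    simp [lineDeriv]
  have hproduct : ∀ᵐ x ∂(volume : Measure Plane).restrict Ω,
      lineDeriv ℝ (fun x => u x * ψ x) x y
        = u x * fderiv ℝ ψ x y + inner ℝ (gradient u x) y * ψ x := by
    filter_upwards [hdiff] with x hx
    rw [(hx.fun_mul (hψ.differentiable x)).lineDeriv_eq_fderiv,
      fderiv_fun_mul hx (hψ.differentiable x), inner_gradient_left]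
    simp [mul_comm]
  have hint : Integrable (fun x => u x * fderiv ℝ ψ x y) (volume.restrict Ω) :=
    hu.integrable_mul (hψ.memLp_fderiv_apply 2 _ y)
  rw [← setIntegral_eq_integral_of_forall_compl_eq_zero hsupp, integral_congr_ae hproduct,
    integral_add hint (hψ.integrable_inner_mul hgrad y)] at hzero
  linarith

lemma lipschitzWith_mul_of_abs_le {X : Type*} [PseudoMetricSpace X] {f g : X → ℝ} {A B : NNReal}
    (hf : LipschitzWith K f) (hg : LipschitzWith L g) (hA : ∀ x, |f x| ≤ A) (hB : ∀ x, |g x| ≤ B) :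
    LipschitzWith (A * L + B * K) fun x => f x * g x := by
  refine LipschitzWith.of_dist_le_mul fun x y => ?_
  have hfxy := hf.dist_le_mul x y
  have hgxy := hg.dist_le_mul x y
  rw [Real.dist_eq] at hfxy hgxy ⊢
  calc |f x * g x - f y * g y| = |f x * (g x - g y) + g y * (f x - f y)| := by ring_nf
    _ ≤ |f x| * |g x - g y| + |g y| * |f x - f y| := by
        rw [← abs_mul, ← abs_mul]
        exact abs_add_le _ _
    _ ≤ A * (L * dist x y) + B * (K * dist x y) := by gcongr; exacts [hA x, hB y]
    _ = (A * L + B * K : NNReal) * dist x y := by push_cast; ring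

lemma hasCompactSupport_of_eq_zero (hb : Bornology.IsBounded Ω) (h0 : ∀ x ∉ Ω, u x = 0) :
    HasCompactSupport u :=
  HasCompactSupport.intro' hb.isCompact_closure isClosed_closure fun x hx =>
    h0 x fun h => hx (subset_closure h)

lemma hasWeakGrad_gradient_of_lipschitzWith (hb : Bornology.IsBounded Ω) (hu : LipschitzWith K u)
    (hc : HasCompactSupport u) : HasWeakGrad Ω u (gradient u) := by
  have := isFiniteMeasure_restrict_of_isBounded hb
  refine hasWeakGrad_gradient_of_lipschitzWith_mul (hu.continuous.memLp_of_hasCompactSupport hc)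
    (MemLp.of_bound (measurable_gradient u).aestronglyMeasurable K (ae_of_all _ fun x =>
      (norm_gradient u x).trans_le (norm_fderiv_le_of_lipschitz ℝ hu)))
    (ae_restrict_of_ae hu.ae_differentiableAt) fun ψ hψ => ?_
  obtain ⟨A, hA⟩ := hu.continuous.bounded_above_of_compact_support hc
  obtain ⟨B, hB⟩ := hψ.1.continuous.bounded_above_of_compact_support hψ.2.1
  obtain ⟨L, hL⟩ := hψ.1.lipschitzWith_of_hasCompactSupport hψ.2.1 (by simp)
  exact ⟨_, lipschitzWith_mul_of_abs_le hu hL (fun x => (hA x).trans (Real.le_coe_toNNReal A))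
    fun x => (hB x).trans (Real.le_coe_toNNReal B)⟩

/-- The truncation of `u` to values in `[-δ, δ]`. It is small in `H¹` for small `δ`, while
`u - clamp δ u` vanishes wherever `|u| ≤ δ`, so that its support is compactly contained in `Ω`. -/
def clamp (δ : ℝ) (u : Plane → ℝ) (x : Plane) : ℝ := max (-δ) (min δ (u x))

lemma lipschitzWith_clamp (hu : LipschitzWith K u) (δ : ℝ) : LipschitzWith K (clamp δ u) :=
  (hu.const_min δ).const_max (-δ)

lemma abs_clamp_le {δ : ℝ} (hδ : 0 ≤ δ) (x : Plane) : |clamp δ u x| ≤ δ :=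
  abs_le.2 ⟨le_max_left _ _, max_le (by linarith) (min_le_left _ _)⟩

lemma clamp_of_abs_le {δ : ℝ} {x : Plane} (h : |u x| ≤ δ) : clamp δ u x = u x := by
  rw [clamp, min_eq_right (abs_le.1 h).2, max_eq_right (abs_le.1 h).1]

lemma fderiv_clamp_eq_zero (hu : Continuous u) {δ : ℝ} (hδ : 0 < δ) {x : Plane}
    (hx : δ < |u x|) : fderiv ℝ (clamp δ u) x = 0 := by
  obtain ⟨c, hc⟩ : ∃ c, clamp δ u =ᶠ[nhds x] fun _ => c := by
    rcases lt_abs.1 hx with h | h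
    · refine ⟨δ, ?_⟩
      filter_upwards [hu.continuousAt.eventually_const_lt h] with y hy
      rw [clamp, min_eq_left hy.le, max_eq_right (by linarith)]
    · refine ⟨-δ, ?_⟩
      filter_upwards [hu.continuousAt.eventually_lt_const (lt_neg.1 h)] with y hy
      rw [clamp, min_eq_right (by linarith), max_eq_left hy.le]
  rw [hc.fderiv_eq, fderiv_const_apply]

lemma ae_eventually_gradient_clamp_eq_zero (hu : LipschitzWith K u) {δ : ℕ → ℝ}
    (hδ : ∀ m, 0 < δ m) (hlim : Filter.Tendsto δ Filter.atTop (nhds 0)) :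
    ∀ᵐ x, ∀ᶠ m in Filter.atTop, gradient (clamp (δ m) u) x = 0 := by
  filter_upwards [ae_fderiv_eq_zero_of_eq_zero (μ := volume) hu] with x hx
  by_cases hux : u x = 0
  · refine Filter.Eventually.of_forall fun m => ?_
    have hev : clamp (δ m) u =ᶠ[nhds x] u := by
      filter_upwards [hu.continuous.abs.continuousAt.eventually_lt_const
        (show |u x| < δ m by simpa [hux] using hδ m)] with y hy
      exact clamp_of_abs_le hy.le
    rw [gradient, hev.fderiv_eq, hx hux, map_zero]
  · filter_upwards [hlim.eventually_lt_const (abs_pos.2 hux)] with m hm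
    rw [gradient, fderiv_clamp_eq_zero hu.continuous (hδ m) hm, map_zero]

lemma exists_clamp_eLpNorm_lt (hu : LipschitzWith K u) (hb : Bornology.IsBounded Ω)
    {η : ENNReal} (hη : 0 < η) : ∃ δ : ℝ, 0 < δ ∧
      eLpNorm (clamp δ u) 2 (volume.restrict Ω) < η ∧
      eLpNorm (gradient (clamp δ u)) 2 (volume.restrict Ω) < η := by
  have := isFiniteMeasure_restrict_of_isBounded hb
  let δ : ℕ → ℝ := fun m => 1 / ((m : ℝ) + 1)
  have hδ : ∀ m, 0 < δ m := fun m => Nat.one_div_pos_of_nat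
  have hlim : Filter.Tendsto δ Filter.atTop (nhds 0) := tendsto_one_div_add_atTop_nhds_zero_nat
  have hvalue := tendsto_eLpNorm_zero_of_bounded (μ := volume.restrict Ω)
    (F := fun m => clamp (δ m) u) two_ne_zero ENNReal.ofNat_ne_top 1
    (fun m => (lipschitzWith_clamp hu _).continuous.aestronglyMeasurable)
    (fun m => ae_of_all _ fun x => (abs_clamp_le (hδ m).le x).trans
      (div_le_self zero_le_one (by simp)))
    (ae_of_all _ fun x => squeeze_zero_norm (fun m => abs_clamp_le (hδ m).le x) hlim)
  have hgradient := tendsto_eLpNorm_zero_of_bounded (μ := volume.restrict Ω)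
    (F := fun m => gradient (clamp (δ m) u)) two_ne_zero ENNReal.ofNat_ne_top K
    (fun m => (measurable_gradient _).aestronglyMeasurable)
    (fun m => ae_of_all _ fun x => (norm_gradient _ x).trans_le
      (norm_fderiv_le_of_lipschitz ℝ (lipschitzWith_clamp hu _)))
    (ae_restrict_of_ae ((ae_eventually_gradient_clamp_eq_zero hu hδ hlim).mono fun x hx =>
      tendsto_const_nhds.congr' (hx.mono fun m => Eq.symm)))
  obtain ⟨m, hm⟩ := ((hvalue.eventually_lt_const hη).and (hgradient.eventually_lt_const hη)).exists
  exact ⟨δ m, hδ m, hm⟩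

lemma tsupport_sub_clamp_subset (hu : Continuous u) (h0 : ∀ x ∉ Ω, u x = 0) {δ : ℝ}
    (hδ : 0 < δ) : tsupport (fun x => u x - clamp δ u x) ⊆ Ω := by
  have hsub : tsupport (fun x => u x - clamp δ u x) ⊆ {x | δ ≤ |u x|} :=
    closure_minimal (fun x hx => show δ ≤ |u x| from not_lt.1 fun h =>
      hx (by simp [clamp_of_abs_le h.le]))
      (isClosed_le continuous_const hu.abs)
  refine hsub.trans fun x hx => by_contra fun hxΩ => hδ.not_ge ?_
  simpa [h0 x hxΩ] using hx

lemma memH10_of_lipschitzWith (hΩ : IsOpen Ω) (hb : Bornology.IsBounded Ω)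
    (hu : LipschitzWith K u) (h0 : ∀ x ∉ Ω, u x = 0) : MemH10 Ω u := by
  have hw := hasWeakGrad_gradient_of_lipschitzWith hb hu (hasCompactSupport_of_eq_zero hb h0)
  refine ⟨⟨_, hw⟩, fun η hη => ?_⟩
  obtain ⟨δ, hδ, hclamp, hclampgrad⟩ := exists_clamp_eLpNorm_lt hu hb (ENNReal.half_pos hη.ne')
  have hclampL := lipschitzWith_clamp hu δ
  have hsupp := tsupport_sub_clamp_subset hu.continuous h0 hδ
  obtain ⟨ψ, hψ, hψv, hψg⟩ := exists_isTestFunction_eLpNorm_lt hΩ hb (hu.sub hclampL)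
    (hb.isCompact_closure.of_isClosed_subset (isClosed_tsupport _)
      (hsupp.trans subset_closure)) hsupp (ENNReal.half_pos hη.ne')
  refine ⟨ψ, hψ, ?_, ?_⟩
  · have hsplit : (fun x => u x - ψ x) = clamp δ u + fun x => u x - clamp δ u x - ψ x := by
      ext x
      simp only [Pi.add_apply]
      ring
    rw [hsplit, ← ENNReal.add_halves η]
    exact (eLpNorm_add_le hclampL.continuous.aestronglyMeasurable
      ((hu.continuous.sub hclampL.continuous).sub hψ.1.continuous).aestronglyMeasurable
      one_le_two).trans_lt (ENNReal.add_lt_add hclamp hψv)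
  · have hsplit : (fun x => weakGrad Ω u x - gradient ψ x) =ᵐ[volume.restrict Ω]
        gradient (clamp δ u) +
          fun x => gradient (fun x => u x - clamp δ u x) x - gradient ψ x := by
      filter_upwards [hw.weakGrad_ae_eq hΩ, ae_restrict_of_ae hu.ae_differentiableAt,
        ae_restrict_of_ae hclampL.ae_differentiableAt] with x hx hd hdc
      simp only [Pi.add_apply, hx, gradient, fderiv_fun_sub hd hdc, map_sub]
      abel
    rw [eLpNorm_congr_ae hsplit, ← ENNReal.add_halves η]
    exact (eLpNorm_add_le (measurable_gradient _).aestronglyMeasurable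
      ((measurable_gradient _).sub (measurable_gradient _)).aestronglyMeasurable
      one_le_two).trans_lt (ENNReal.add_lt_add hclampgrad hψg)

end LipschitzH10

/-! ### Piecewise affine functions -/

section AffineMap

variable {E F : Type*} [NormedAddCommGroup E] [NormedSpace ℝ E] [FiniteDimensional ℝ E]
  [NormedAddCommGroup F] [NormedSpace ℝ F]

lemma hasFDerivAt_affineMap (l : E →ᵃ[ℝ] F) (x : E) :
    HasFDerivAt l l.linear.toContinuousLinearMap x :=
  ContinuousAffineMap.hasFDerivAt ⟨l, l.continuous_of_finiteDimensional⟩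

lemma contDiff_affineMap (l : E →ᵃ[ℝ] F) : ContDiff ℝ ∞ l :=
  ContinuousAffineMap.contDiff ⟨l, l.continuous_of_finiteDimensional⟩

end AffineMap

namespace Triangulation

variable {T : Triangulation Ω} {V : Type*} [NormedAddCommGroup V]

lemma isCompact_closure (T : Triangulation Ω) : IsCompact (closure Ω) :=
  T.cover ▸ T.cells.isCompact_biUnion fun t _ => isCompact_tri t

lemma isBounded (T : Triangulation Ω) : Bornology.IsBounded Ω :=
  T.isCompact_closure.isBounded.subset subset_closure

lemma exists_lipschitzOnWith (T : Triangulation Ω) {F : Plane → V}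
    (hF : ∀ t ∈ T.cells, ∃ K, LipschitzOnWith K F (tri t)) :
    ∃ K, ∀ t ∈ T.cells, LipschitzOnWith K F (tri t) := by
  choose! K hK using hF
  exact ⟨∑ t ∈ T.cells, K t, fun t ht =>
    (hK t ht).weaken (Finset.single_le_sum (fun _ _ => zero_le) ht)⟩

lemma exists_lipschitzWith (T : Triangulation Ω) (hΩ : IsOpen Ω) {F : Plane → V}
    (h0 : ∀ x ∉ Ω, F x = 0) (hF : ∀ t ∈ T.cells, ∃ K, LipschitzOnWith K F (tri t)) :
    ∃ K, LipschitzWith K F := by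
  obtain ⟨K, hK⟩ := T.exists_lipschitzOnWith hF
  refine ⟨K, lipschitzWith_of_closed_cover (S := fun i : Option T.cells => i.elim Ωᶜ fun t => tri t)
    (Option.forall.2 ⟨hΩ.isClosed_compl, fun _ => isClosed_tri _⟩)
    (Set.eq_univ_of_forall fun x => ?_) (Option.forall.2 ⟨fun x hx y hy => ?_, fun t => hK t t.2⟩)⟩
  · by_cases hx : x ∈ Ω
    · obtain ⟨t, ht, hxt⟩ := T.exists_mem_tri (subset_closure hx)
      exact Set.mem_iUnion.2 ⟨some ⟨t, ht⟩, hxt⟩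
    · exact Set.mem_iUnion.2 ⟨none, hx⟩
  · simp [h0 x hx, h0 y hy]

variable [NormedSpace ℝ V]

/-- Functions that agree with an affine map on each closed triangle, and hence are continuous on
the closure of `Ω`. -/
def IsPiecewiseAffine (T : Triangulation Ω) (u : Plane → V) : Prop :=
  ∀ t ∈ T.cells, ∃ l : Plane →ᵃ[ℝ] V, Set.EqOn u l (tri t)

namespace IsPiecewiseAffine

lemma lipschitzOnWith_tri {u : Plane → V} (hu : T.IsPiecewiseAffine u) :
    ∀ t ∈ T.cells, ∃ K, LipschitzOnWith K u (tri t) := fun t ht => by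
  obtain ⟨l, hl⟩ := hu t ht
  obtain ⟨K, hK⟩ := l.lipschitzWith_of_finiteDimensional
  exact ⟨K, fun x hx y hy => by simpa only [hl hx, hl hy] using hK x y⟩

lemma continuousOn {u : Plane → V} (hu : T.IsPiecewiseAffine u) :
    ContinuousOn u (closure Ω) := by
  obtain ⟨K, hK⟩ := T.exists_lipschitzOnWith hu.lipschitzOnWith_tri
  rw [← T.iUnion_tri]
  exact (locallyFinite_of_finite _).continuousOn_iUnion (fun _ => isClosed_tri _)
    fun t => (hK t t.2).continuousOn

lemma memLp {u : Plane → V} (hu : T.IsPiecewiseAffine u) (hΩ : MeasurableSet Ω) (p : ENNReal) :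
    MemLp u p (volume.restrict Ω) := by
  have := isFiniteMeasure_restrict_of_isBounded T.isBounded
  obtain ⟨C, hC⟩ := T.isCompact_closure.exists_bound_of_continuousOn hu.continuousOn
  refine MemLp.of_bound ((hu.continuousOn.mono subset_closure).aestronglyMeasurable hΩ) C ?_
  filter_upwards [ae_restrict_mem hΩ] with x hx
  exact hC x (subset_closure hx)

lemma ae_differentiableAt {u : Plane → V} (hu : T.IsPiecewiseAffine u) (hΩ : MeasurableSet Ω) :
    ∀ᵐ x ∂(volume : Measure Plane).restrict Ω, DifferentiableAt ℝ u x := by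
  filter_upwards [T.ae_exists_mem_interior hΩ] with x ⟨t, ht, hx⟩
  obtain ⟨l, hl⟩ := hu t ht
  exact (hl.eventuallyEq_of_mem (mem_interior_iff_mem_nhds.1 hx)).differentiableAt_iff.2
    (hasFDerivAt_affineMap l x).differentiableAt

variable {u : Plane → ℝ}

lemma memLp_gradient (hu : T.IsPiecewiseAffine u) (hΩ : MeasurableSet Ω) (p : ENNReal) :
    MemLp (gradient u) p (volume.restrict Ω) := by
  have := isFiniteMeasure_restrict_of_isBounded T.isBounded
  obtain ⟨K, hK⟩ := T.exists_lipschitzOnWith hu.lipschitzOnWith_tri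
  refine MemLp.of_bound (measurable_gradient u).aestronglyMeasurable K ?_
  filter_upwards [T.ae_exists_mem_interior hΩ] with x ⟨t, ht, hx⟩
  rw [norm_gradient]
  exact norm_fderiv_le_of_lipschitzOn ℝ (mem_interior_iff_mem_nhds.1 hx) (hK t ht)

lemma hasWeakGrad (hu : T.IsPiecewiseAffine u) (hΩ : IsOpen Ω) :
    HasWeakGrad Ω u (gradient u) := by
  refine hasWeakGrad_gradient_of_lipschitzWith_mul (hu.memLp hΩ.measurableSet 2)
    (hu.memLp_gradient hΩ.measurableSet 2) (hu.ae_differentiableAt hΩ.measurableSet)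
    fun ψ hψ => T.exists_lipschitzWith hΩ (fun x hx => by rw [hψ.eq_zero hx, mul_zero])
      fun t ht => ?_
  obtain ⟨l, hl⟩ := hu t ht
  obtain ⟨K, hK⟩ := ((contDiff_affineMap l).mul hψ.1).lipschitzWith_of_hasCompactSupport
    hψ.2.1.mul_left (by simp)
  refine ⟨K, fun x hx y hy => ?_⟩
  simpa only [Pi.mul_apply, hl hx, hl hy] using hK x y

lemma memH10 (hu : T.IsPiecewiseAffine u) (hΩ : IsOpen Ω) (h0 : ∀ x ∉ Ω, u x = 0) :
    MemH10 Ω u := by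
  obtain ⟨K, hK⟩ := T.exists_lipschitzWith hΩ h0 hu.lipschitzOnWith_tri
  exact memH10_of_lipschitzWith hΩ T.isBounded hK h0

end IsPiecewiseAffine

end Triangulation

/-! ### The nodal basis -/

namespace Triangulation

variable {T : Triangulation Ω} {s t : Finset Plane} {z w x : Plane}

/-- The barycentric coordinate of the vertex `z` of the triangle `t`. -/
def bary (T : Triangulation Ω) (t : Finset Plane) (ht : t ∈ T.cells) (z : t) : Plane →ᵃ[ℝ] ℝ :=
  (T.affineBasis t ht).coord z

lemma bary_self (ht : t ∈ T.cells) (z : t) : T.bary t ht z z = 1 :=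
  (T.affineBasis t ht).coord_apply_eq z

lemma bary_of_ne (ht : t ∈ T.cells) (z : t) (hw : w ∈ t) (hne : (z : Plane) ≠ w) :
    T.bary t ht z w = 0 :=
  (T.affineBasis t ht).coord_apply_ne (i := z) (j := ⟨w, hw⟩) fun h => hne (congrArg Subtype.val h)

lemma sum_bary (ht : t ∈ T.cells) (x : Plane) : ∑ z : t, T.bary t ht z x = 1 :=
  (T.affineBasis t ht).sum_coord_apply_eq_one x

lemma bary_mem_Icc (ht : t ∈ T.cells) (z : t) (hx : x ∈ tri t) :
    T.bary t ht z x ∈ Set.Icc (0 : ℝ) 1 := by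
  refine convexHull_min (t := T.bary t ht z ⁻¹' Set.Icc (0 : ℝ) 1) (fun w hw => ?_)
    ((convex_Icc 0 1).affine_preimage _) hx
  rcases eq_or_ne (z : Plane) w with rfl | h
  · simp [bary_self]
  · simp [bary_of_ne ht z hw h]

lemma exists_nodalBasis_eq (T : Triangulation Ω)
    (h : ∃ t, ∃ _ : t ∈ T.cells, z ∈ t ∧ x ∈ tri t) :
    ∃ s, ∃ hs : s ∈ T.cells, ∃ hzs : z ∈ s, x ∈ tri s ∧
      T.nodalBasis z x = T.bary s hs ⟨z, hzs⟩ x :=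
  ⟨h.choose, h.choose_spec.1, h.choose_spec.2.1, h.choose_spec.2.2, dif_pos h⟩

lemma eq_of_eqOn_common_vertices (hs : s ∈ T.cells) (ht : t ∈ T.cells) {l m : Plane →ᵃ[ℝ] ℝ}
    (h : Set.EqOn l m (s ∩ t)) (hxs : x ∈ tri s) (hxt : x ∈ tri t) : l x = m x :=
  AffineMap.eqOn_affineSpan h <| convexHull_subset_affineSpan _ <| T.inter s hs t ht ▸ ⟨hxs, hxt⟩

lemma nodalBasis_of_mem (T : Triangulation Ω) (ht : t ∈ T.cells) (hz : z ∈ t)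
    (hx : x ∈ tri t) : T.nodalBasis z x = T.bary t ht ⟨z, hz⟩ x := by
  obtain ⟨s, hs, hzs, hxs, heq⟩ := T.exists_nodalBasis_eq ⟨t, ht, hz, hx⟩
  rw [heq]
  refine eq_of_eqOn_common_vertices hs ht (fun w hw => ?_) hxs hx
  rcases eq_or_ne z w with rfl | hzw
  · exact (bary_self hs ⟨z, hzs⟩).trans (bary_self ht ⟨z, hz⟩).symm
  · rw [bary_of_ne hs ⟨z, hzs⟩ hw.1 hzw, bary_of_ne ht ⟨z, hz⟩ hw.2 hzw]

lemma nodalBasis_of_notMem (T : Triangulation Ω) (ht : t ∈ T.cells) (hz : z ∉ t)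
    (hx : x ∈ tri t) : T.nodalBasis z x = 0 := by
  by_cases h : ∃ t, ∃ _ : t ∈ T.cells, z ∈ t ∧ x ∈ tri t
  · obtain ⟨s, hs, hzs, hxs, heq⟩ := T.exists_nodalBasis_eq h
    rw [heq]
    exact eq_of_eqOn_common_vertices (m := AffineMap.const ℝ Plane 0) hs ht
      (fun w hw => bary_of_ne hs ⟨z, hzs⟩ hw.1 (ne_of_mem_of_not_mem hw.2 hz).symm) hxs hx
  · exact dif_neg h

lemma nodalBasis_of_notMem_closure (T : Triangulation Ω) (hx : x ∉ closure Ω) :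
    T.nodalBasis z x = 0 :=
  dif_neg fun ⟨_, ht, _, hxt⟩ => hx (T.tri_subset ht hxt)

lemma mem_vertices (T : Triangulation Ω) : z ∈ T.vertices ↔ ∃ t ∈ T.cells, z ∈ t := by
  simp [vertices]

lemma sum_nodalBasis {V : Type*} [AddCommGroup V] [Module ℝ V] (T : Triangulation Ω)
    (ht : t ∈ T.cells) (a : Plane → V) (hx : x ∈ tri t) :
    ∑ z ∈ T.vertices, T.nodalBasis z x • a z = ∑ z : t, T.bary t ht z x • a z := by
  have hsub : t ⊆ T.vertices := fun z hz => T.mem_vertices.2 ⟨t, ht, hz⟩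
  rw [← Finset.sum_subset hsub fun z _ hz => by rw [T.nodalBasis_of_notMem ht hz hx, zero_smul],
    ← Finset.sum_coe_sort t]
  exact Finset.sum_congr rfl fun z _ => by rw [T.nodalBasis_of_mem ht z.2 hx]

lemma isPiecewiseAffine_sum_nodalBasis {V : Type*} [NormedAddCommGroup V] [NormedSpace ℝ V]
    (T : Triangulation Ω) (a : Plane → V) :
    T.IsPiecewiseAffine fun x => ∑ z ∈ T.vertices, T.nodalBasis z x • a z := fun t ht => by
  refine ⟨(Fintype.linearCombination ℝ fun z : t => a z).toAffineMap.comp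
    (AffineMap.pi fun z => T.bary t ht z), fun x hx => ?_⟩
  simpa [Fintype.linearCombination_apply] using T.sum_nodalBasis ht a hx

/-! ### Shape regular triangulations -/

lemma abs_bary_linear_le (ht : t ∈ T.cells) (z : t) {r : ℝ} (hr : 0 < r)
    (hb : Metric.closedBall x r ⊆ tri t) (v : Plane) :
    |(T.bary t ht z).linear v| ≤ 1 / r * ‖v‖ := by
  refine LinearMap.bound_of_ball_bound' hr 1 (T.bary t ht z).linear (fun v hv => ?_) v
  have hx := bary_mem_Icc ht z (hb (Metric.mem_closedBall_self hr.le))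
  have hxv := bary_mem_Icc ht z (x := v +ᵥ x) (hb (by simpa using hv))
  rw [AffineMap.map_vadd, vadd_eq_add] at hxv
  exact abs_le.2 ⟨by linarith [hx.2, hxv.1], by linarith [hx.1, hxv.2]⟩

lemma exists_mem_ne (ht : t ∈ T.cells) (z : Plane) : ∃ w ∈ t, w ≠ z :=
  Finset.exists_mem_ne (by rw [T.card_eq t ht]; norm_num) z

lemma cellDiam_pos (ht : t ∈ T.cells) : 0 < cellDiam t := by
  obtain ⟨a, ha, -⟩ := T.exists_mem_ne ht 0
  obtain ⟨b, hb, hba⟩ := T.exists_mem_ne ht a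
  exact (dist_pos.2 hba).trans_le (dist_le_cellDiam (mem_tri hb) (mem_tri ha))

lemma ShapeRegular.pos {σ : ℝ} (hσ : T.ShapeRegular σ) (ht : t ∈ T.cells) : 0 < σ := by
  obtain ⟨x, r, hr, -, h⟩ := hσ t ht
  exact pos_of_mul_pos_left ((cellDiam_pos ht).trans_le h) hr.le

lemma ShapeRegular.cellDiam_le_mul_dist {σ : ℝ} (hσ : T.ShapeRegular σ) (ht : t ∈ T.cells)
    (hz : z ∈ t) (hw : w ∈ t) (hzw : z ≠ w) : cellDiam t ≤ σ * dist z w := by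
  obtain ⟨x, r, hr, hb, h⟩ := hσ t ht
  have hone : (T.bary t ht ⟨z, hz⟩).linear (z - w) = 1 := by
    have hsub := (T.bary t ht ⟨z, hz⟩).linearMap_vsub z w
    rw [vsub_eq_sub, vsub_eq_sub, bary_of_ne ht ⟨z, hz⟩ hw hzw, sub_zero] at hsub
    exact hsub.trans (bary_self ht ⟨z, hz⟩)
  have hle := abs_bary_linear_le ht ⟨z, hz⟩ hr hb (z - w)
  rw [hone, abs_one, one_div_mul_eq_div, le_div_iff₀ hr, one_mul, ← dist_eq_norm] at hle
  exact h.trans (mul_le_mul_of_nonneg_left hle (hσ.pos ht).le)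

end Triangulation

section Packing

variable {E : Type*} [NormedAddCommGroup E] [NormedSpace ℝ E]

lemma closedBall_homothety_subset {S : Set E} (hS : Convex ℝ S) {z x : E} {r D k : ℝ}
    (hz : z ∈ S) (hb : Metric.closedBall x r ⊆ S) (hD : S ⊆ Metric.closedBall z D)
    (hk0 : 0 < k) (hk1 : k ≤ 1) :
    Metric.closedBall (AffineMap.homothety z k x) (k * r) ⊆ S ∩ Metric.closedBall z (k * D) := by
  intro y hy
  obtain ⟨w, rfl⟩ : ∃ w, AffineMap.homothety z k w = y :=
    ⟨AffineMap.homothety z k⁻¹ y, by simp [AffineMap.homothety_apply, smul_smul, hk0.ne']⟩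
  have hw : w ∈ S := hb <| by
    rwa [Metric.mem_closedBall, dist_eq_norm, ← vsub_eq_sub, ← AffineMap.linearMap_vsub,
      AffineMap.homothety_linear, LinearMap.smul_apply, norm_smul, Real.norm_of_nonneg hk0.le,
      mul_le_mul_iff_right₀ hk0, LinearMap.id_apply, vsub_eq_sub, ← dist_eq_norm] at hy
  refine ⟨hS.lineMap_mem hz hw ⟨hk0.le, hk1⟩, ?_⟩
  rw [Metric.mem_closedBall, dist_homothety_center, Real.norm_of_nonneg hk0.le, dist_comm]
  exact mul_le_mul_of_nonneg_left (hD hw) hk0.le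

lemma card_mul_pow_le_of_closedBall_subset [FiniteDimensional ℝ E] [MeasurableSpace E]
    [BorelSpace E] (μ : Measure E) [μ.IsAddHaarMeasure] {ι : Type*} {A : Finset ι} {c : ι → E}
    {r R : ℝ} {z : E} (hr : 0 ≤ r) (hR : 0 ≤ R)
    (hdisj : (A : Set ι).Pairwise
      (Function.onFun (AEDisjoint μ) fun i => Metric.closedBall (c i) r))
    (hsub : ∀ i ∈ A, Metric.closedBall (c i) r ⊆ Metric.closedBall z R) :
    A.card * r ^ Module.finrank ℝ E ≤ R ^ Module.finrank ℝ E := by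
  have hmeas : ∑ i ∈ A, μ (Metric.closedBall (c i) r) ≤ μ (Metric.closedBall z R) := by
    rw [← measure_biUnion_finset₀ hdisj fun _ _ => measurableSet_closedBall.nullMeasurableSet]
    exact measure_mono (Set.iUnion₂_subset hsub)
  simp only [Measure.addHaar_closedBall μ _ hr, Measure.addHaar_closedBall μ _ hR,
    Finset.sum_const, nsmul_eq_mul] at hmeas
  rwa [← mul_assoc, ENNReal.mul_le_mul_iff_left (Metric.measure_ball_pos _ _ one_pos).ne'
    measure_ball_lt_top.ne, ← ENNReal.ofReal_natCast, ← ENNReal.ofReal_mul (by positivity),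
    ENNReal.ofReal_le_ofReal_iff (by positivity)] at hmeas

end Packing

namespace Triangulation

variable {T : Triangulation Ω} {s t : Finset Plane} {z : Plane} {σ : ℝ}

lemma ShapeRegular.exists_closedBall_subset (hσ : T.ShapeRegular σ) (ht : t ∈ T.cells)
    (hz : z ∈ tri t) {ρ : ℝ} (hρ0 : 0 < ρ) (hρ : ρ ≤ cellDiam t) :
    ∃ c, Metric.closedBall c (ρ / σ) ⊆ tri t ∩ Metric.closedBall z ρ := by
  obtain ⟨x, r, _, hb, h⟩ := hσ t ht
  have hd : 0 < cellDiam t := cellDiam_pos ht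
  have hball := closedBall_homothety_subset (convex_tri t) hz hb
    (fun _ hy => dist_le_cellDiam hy hz) (div_pos hρ0 hd) ((div_le_one hd).2 hρ)
  rw [div_mul_cancel₀ _ hd.ne'] at hball
  refine ⟨_, (Metric.closedBall_subset_closedBall ?_).trans hball⟩
  rw [div_mul_eq_mul_div, div_le_div_iff₀ (hσ.pos ht) hd, mul_assoc, mul_comm r]
  exact mul_le_mul_of_nonneg_left h hρ0.le

/-- Each triangle of `A` contains a disc of radius `ρ / σ` in the disc of radius `ρ` about `z`,
where `ρ` is the least diameter in `A`; then compare areas. -/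
lemma ShapeRegular.card_le_sq (hσ : T.ShapeRegular σ) {A : Finset (Finset Plane)}
    (hA : ∀ t ∈ A, t ∈ T.cells ∧ z ∈ t) : (A.card : ℝ) ≤ σ ^ 2 := by
  rcases A.eq_empty_or_nonempty with rfl | hne
  · simpa using sq_nonneg σ
  obtain ⟨t₀, ht₀, hmin⟩ := A.exists_min_image cellDiam hne
  have hρ : 0 < cellDiam t₀ := cellDiam_pos (hA t₀ ht₀).1
  have hσ0 : 0 < σ := hσ.pos (hA t₀ ht₀).1
  choose! c hc using fun t ht =>
    hσ.exists_closedBall_subset (hA t ht).1 (mem_tri (hA t ht).2) hρ (hmin t ht)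
  have hcard := card_mul_pow_le_of_closedBall_subset volume (div_pos hρ hσ0).le hρ.le
    (fun s hs t ht hst => measure_mono_null
      (Set.inter_subset_inter ((hc s hs).trans Set.inter_subset_left)
        ((hc t ht).trans Set.inter_subset_left))
      (T.volume_tri_inter (hA s hs).1 (hA t ht).1 hst))
    fun t ht => (hc t ht).trans Set.inter_subset_right
  rw [finrank_euclideanSpace_fin, div_pow, mul_div_assoc', div_le_iff₀ (by positivity),
    mul_comm (cellDiam t₀ ^ 2)] at hcard
  exact le_of_mul_le_mul_right hcard (by positivity)

lemma mem_of_mem_tri (hs : s ∈ T.cells) (hzs : z ∈ s) (ht : t ∈ T.cells) (hzt : z ∈ tri t) :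
    z ∈ t := by
  by_contra h
  have h0 := T.nodalBasis_of_notMem ht h hzt
  rw [T.nodalBasis_of_mem hs hzs (mem_tri hzs)] at h0
  exact one_ne_zero ((bary_self hs ⟨z, hzs⟩).symm.trans h0)

lemma eventually_mem_of_mem_tri (hs : s ∈ T.cells) (hzs : z ∈ s) :
    ∀ᶠ x in nhds z, ∀ t ∈ T.cells, x ∈ tri t → z ∈ t := by
  refine (Finset.eventually_all _).2 fun t ht => ?_
  by_cases hzt : z ∈ t
  · exact Filter.Eventually.of_forall fun _ _ => hzt
  · have hnhds := (isClosed_tri t).isOpen_compl.mem_nhds (mt (mem_of_mem_tri hs hzs ht) hzt)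
    filter_upwards [hnhds] with x hx hxt using absurd hxt hx

lemma eventually_sphere_inter_tri_nonempty (ht : t ∈ T.cells) (hz : z ∈ t) :
    ∀ᶠ ρ in nhdsWithin (0 : ℝ) (Set.Ioi 0), (Metric.sphere z ρ ∩ tri t).Nonempty := by
  obtain ⟨w, hw, hwz⟩ := T.exists_mem_ne ht z
  filter_upwards [Ioc_mem_nhdsGT (dist_pos.2 hwz)] with ρ hρ
  obtain ⟨x, hx, hxρ⟩ := (convex_tri t).isPreconnected.intermediate_value (mem_tri hz)
    (mem_tri hw) (f := fun x => dist x z) (by fun_prop) ⟨by simpa using hρ.1.le, hρ.2⟩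
  exact ⟨x, hxρ, hx⟩

lemma exists_sphere_subset_patch (hΩ : IsOpen Ω) (hz : z ∈ Ω) (hs : s ∈ T.cells) (hzs : z ∈ s) :
    ∃ ρ : ℝ, 0 < ρ ∧ (∀ x ∈ Metric.sphere z ρ, ∃ t ∈ T.cells, z ∈ t ∧ x ∈ tri t) ∧
      ∀ t ∈ T.cells, z ∈ t → (Metric.sphere z ρ ∩ tri t).Nonempty := by
  obtain ⟨r, hr, hball⟩ := Metric.eventually_nhds_iff.1
    ((hΩ.eventually_mem hz).and (eventually_mem_of_mem_tri hs hzs))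
  have hmeet : ∀ᶠ ρ in nhdsWithin (0 : ℝ) (Set.Ioi 0), ∀ t ∈ T.cells, z ∈ t →
      (Metric.sphere z ρ ∩ tri t).Nonempty := (Finset.eventually_all _).2 fun t ht =>
    Filter.eventually_imp_distrib_left.2 fun hzt => eventually_sphere_inter_tri_nonempty ht hzt
  obtain ⟨ρ, hρ, hρr⟩ := (hmeet.and (Ioo_mem_nhdsGT hr)).exists
  refine ⟨ρ, hρr.1, fun x hx => ?_, hρ⟩
  obtain ⟨hxΩ, hxt⟩ := hball ((Metric.mem_sphere.1 hx).trans_lt hρr.2)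
  obtain ⟨t, ht, hxt'⟩ := T.exists_mem_tri (subset_closure hxΩ)
  exact ⟨t, ht, hxt t ht hxt', hxt'⟩

/-- A small circle about an interior vertex `z` is connected and covered by the triangles at `z`,
so that it meets a triangle with and a triangle without the property `P` in a common point. -/
lemma exists_common_edge (hΩ : IsOpen Ω) (hz : z ∈ Ω) {P : Finset Plane → Prop}
    (hs : s ∈ T.cells) (hzs : z ∈ s) (hsP : P s) (ht : t ∈ T.cells) (hzt : z ∈ t) (htP : ¬P t) :
    ∃ a ∈ T.cells, ∃ b ∈ T.cells, P a ∧ ¬P b ∧ z ∈ a ∧ z ∈ b ∧ ∃ w ∈ a, w ∈ b ∧ w ≠ z := by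
  obtain ⟨ρ, hρ0, hcover, hmeet⟩ := exists_sphere_subset_patch hΩ hz hs hzs
  let patch (Q : Finset Plane → Prop) : Set Plane :=
    ⋃ a ∈ {a | a ∈ T.cells ∧ z ∈ a ∧ Q a}, tri a
  have hpatch : ∀ Q, IsClosed (patch Q) := fun Q =>
    (T.cells.finite_toSet.subset fun _ ha => ha.1).isClosed_biUnion fun a _ => isClosed_tri a
  have hmem {Q a x} (ha : a ∈ T.cells) (hza : z ∈ a) (hQ : Q a) (hx : x ∈ tri a) : x ∈ patch Q :=
    Set.mem_biUnion (show a ∈ {a | a ∈ T.cells ∧ z ∈ a ∧ Q a} from ⟨ha, hza, hQ⟩) hx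
  have hconn : IsPreconnected (Metric.sphere z ρ) :=
    (isConnected_sphere (by simp [← Module.finrank_eq_rank]) z hρ0.le).isPreconnected
  obtain ⟨y, hy, hyP, hyP'⟩ := isPreconnected_closed_iff.1 hconn (patch P) (patch (¬P ·))
    (hpatch _) (hpatch _)
    (fun x hx => by
      obtain ⟨a, ha, hza, hxa⟩ := hcover x hx
      exact (em (P a)).imp (hmem ha hza · hxa) (hmem (Q := (¬P ·)) ha hza · hxa))
    ((hmeet s hs hzs).mono fun y hy => ⟨hy.1, hmem hs hzs hsP hy.2⟩)
    ((hmeet t ht hzt).mono fun y hy => ⟨hy.1, hmem (Q := (¬P ·)) ht hzt htP hy.2⟩)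
  obtain ⟨a, ⟨ha, hza, haP⟩, hya⟩ := Set.mem_iUnion₂.1 hyP
  obtain ⟨b, ⟨hb, hzb, hbP⟩, hyb⟩ := Set.mem_iUnion₂.1 hyP'
  refine ⟨a, ha, b, hb, haP, hbP, hza, hzb, ?_⟩
  by_contra! honly
  have hsub : (a ∩ b : Set Plane) ⊆ {z} := fun w hw => honly w hw.1 hw.2
  have hyz : y ∈ convexHull ℝ {z} := convexHull_mono hsub (T.inter a ha b hb ▸ ⟨hya, hyb⟩)
  rw [convexHull_singleton, Set.mem_singleton_iff] at hyz
  exact hρ0.ne (by simpa [hyz] using hy)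

lemma ShapeRegular.exists_cellDiam_mem_Ioc (hσ : T.ShapeRegular σ) (hΩ : IsOpen Ω)
    (hz : z ∈ Ω) {d : ℝ} (hs : s ∈ T.cells) (hzs : z ∈ s) (hsd : cellDiam s ≤ d)
    (ht : t ∈ T.cells) (hzt : z ∈ t) (htd : d < cellDiam t) :
    ∃ a ∈ T.cells, z ∈ a ∧ cellDiam a ∈ Set.Ioc d (σ * d) := by
  obtain ⟨a, ha, b, hb, had, hbd, hza, hzb, w, hwa, hwb, hwz⟩ :=
    exists_common_edge hΩ hz (P := fun a => cellDiam a ≤ d) hs hzs hsd ht hzt htd.not_ge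
  refine ⟨b, hb, hzb, not_le.1 hbd, (hσ.cellDiam_le_mul_dist hb hzb hwb hwz.symm).trans ?_⟩
  exact mul_le_mul_of_nonneg_left ((dist_le_cellDiam (mem_tri hza) (mem_tri hwa)).trans had)
    (hσ.pos ha).le

open Classical in
lemma ShapeRegular.lt_card_filter (hσ : T.ShapeRegular σ) (hΩ : IsOpen Ω) (hz : z ∈ Ω)
    (hs : s ∈ T.cells) (hzs : z ∈ s) (ht : t ∈ T.cells) (hzt : z ∈ t) {K : ℝ} (hσK : σ ≤ K)
    (hK : 1 ≤ K) {k : ℕ} (hk : K ^ k * cellDiam s < cellDiam t) :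
    k < {a ∈ T.cells | z ∈ a ∧ cellDiam a ≤ K ^ k * cellDiam s}.card := by
  induction k with
  | zero => exact Finset.card_pos.2 ⟨s, Finset.mem_filter.2 ⟨hs, hzs, by simp⟩⟩
  | succ k ih =>
    have hs0 := cellDiam_pos hs
    have hmono : K ^ k * cellDiam s ≤ K ^ (k + 1) * cellDiam s := by
      gcongr
      exact k.le_succ
    obtain ⟨a, ha, hza, hlt, hle⟩ := hσ.exists_cellDiam_mem_Ioc hΩ hz hs hzs
      (le_mul_of_one_le_left hs0.le (one_le_pow₀ hK)) ht hzt (hmono.trans_lt hk)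
    have ha' : cellDiam a ≤ K ^ (k + 1) * cellDiam s := by
      rw [pow_succ', mul_assoc]
      exact hle.trans (by gcongr)
    refine (Nat.succ_le_of_lt (ih (hmono.trans_lt hk))).trans_lt (Finset.card_lt_card ?_)
    refine (Finset.ssubset_iff_of_subset fun b hb => ?_).2 ⟨a, ?_, ?_⟩
    · rw [Finset.mem_filter] at hb ⊢
      exact ⟨hb.1, hb.2.1, hb.2.2.trans hmono⟩
    · exact Finset.mem_filter.2 ⟨ha, hza, ha'⟩
    · exact fun h => hlt.not_ge (Finset.mem_filter.1 h).2.2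

/-- A bound for the ratio of the diameters of two triangles with a common interior vertex, in
triangulations that are shape regular with constant `σ`: at most `σ ^ 2` triangles meet there. -/
def patchRatio (σ : ℝ) : ℝ := max σ 1 ^ ⌈σ ^ 2⌉₊

lemma one_le_patchRatio (σ : ℝ) : 1 ≤ patchRatio σ := one_le_pow₀ (le_max_right _ _)

lemma ShapeRegular.cellDiam_le_mul_cellDiam (hσ : T.ShapeRegular σ) (hΩ : IsOpen Ω) (hz : z ∈ Ω)
    (hs : s ∈ T.cells) (hzs : z ∈ s) (ht : t ∈ T.cells) (hzt : z ∈ t) :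
    cellDiam t ≤ patchRatio σ * cellDiam s := by
  classical
  by_contra! hlt
  have hcard := hσ.lt_card_filter hΩ hz hs hzs ht hzt (le_max_left _ _) (le_max_right _ _) hlt
  have hle := hσ.card_le_sq (z := z) (A := {a ∈ T.cells | z ∈ a ∧
    cellDiam a ≤ patchRatio σ * cellDiam s}) fun a ha =>
      ⟨(Finset.mem_filter.1 ha).1, (Finset.mem_filter.1 ha).2.1⟩
  exact hcard.not_ge (Nat.cast_le.1 (hle.trans (Nat.le_ceil _)))

end Triangulation

/-! ### Quasi-interpolation -/

lemma ae_mem_interior_tri (t : Finset Plane) :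
    ∀ᵐ x ∂(volume : Measure Plane).restrict (tri t), x ∈ interior (tri t) := by
  rw [← Measure.restrict_congr_set
    (interior_ae_eq_of_null_frontier ((convex_tri t).addHaar_frontier volume))]
  exact ae_restrict_mem isOpen_interior.measurableSet

lemma tri_subset_closedBall {t : Finset Plane} {z x : Plane} {R : ℝ} (hz : z ∈ t)
    (h : cellDiam t + dist z x ≤ R) : tri t ⊆ Metric.closedBall x R := fun y hy =>
  ((dist_triangle y z x).trans (by gcongr; exact dist_le_cellDiam hy (mem_tri hz))).trans h

namespace Triangulation

variable {T : Triangulation Ω} {t : Finset Plane} {u : Plane → ℝ} {z : Plane} {σ : ℝ}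

lemma exists_l2norm_sub_const_le (hΩ : IsPolygonalDomain Ω) (hu : MemH10 Ω u)
    {x₀ y₀ : Plane} {R c : ℝ} (hR : 0 < R) (hc : 0 < c)
    (hsub : Metric.closedBall y₀ (c * R) ⊆ Metric.closedBall x₀ R) :
    ∃ y ∈ Metric.closedBall y₀ (c * R), ∀ t ∈ T.cells, tri t ⊆ Metric.closedBall x₀ R →
      l2norm (tri t) (fun x => u x - Ω.indicator u y) ≤ 4 * R / c * l2norm Ω (weakGrad Ω u) := by
  obtain ⟨y, hy, h⟩ := hu.exists_eLpNorm_indicator_sub_const_le hΩ.isOpen hR hc hsub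
  refine ⟨y, hy, fun t ht htR => ?_⟩
  have hcongr : l2norm (tri t) (fun x => u x - Ω.indicator u y)
      = l2norm (tri t) (fun x => Ω.indicator u x - Ω.indicator u y) := by
    refine l2norm_congr (ae_mono (T.restrict_tri_le hΩ.volume_frontier ht) ?_)
    filter_upwards [ae_restrict_mem hΩ.isOpen.measurableSet] with x hx
    rw [Set.indicator_of_mem hx]
  have hle := (eLpNorm_mono_measure (p := 2) (fun x => Ω.indicator u x - Ω.indicator u y)
    (Measure.restrict_mono_set (volume : Measure Plane) htR)).trans h
  rw [hcongr]
  simpa only [l2norm, ENNReal.toReal_mul,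
    ENNReal.toReal_ofReal (show 0 ≤ 4 * R / c by positivity)] using
    ENNReal.toReal_mono (ENNReal.mul_ne_top (by simp) hu.memLp_weakGrad.2.ne) hle

lemma l2norm_tri_le_of_mem_frontier (hΩ : IsPolygonalDomain Ω) {c D : ℝ} (hc : 0 < c)
    (hext : HasExteriorCorkscrew Ω (frontier Ω) c D) (hu : MemH10 Ω u) {x : Plane}
    (hx : x ∈ frontier Ω) {R : ℝ} (hR : 0 < R) (hRD : R ≤ D) (ht : t ∈ T.cells)
    (htR : tri t ⊆ Metric.closedBall x R) :
    l2norm (tri t) u ≤ 4 * R / c * l2norm Ω (weakGrad Ω u) := by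
  obtain ⟨y₀, hy₀⟩ := hext x hx R hR hRD
  obtain ⟨y, hy, h⟩ := T.exists_l2norm_sub_const_le hΩ hu hR hc (hy₀.trans Set.inter_subset_left)
  simpa only [Set.indicator_of_notMem (hy₀ hy).2, sub_zero] using h t ht htR

lemma ShapeRegular.exists_mem_frontier_dist_le (hσ : T.ShapeRegular σ) (hΩ : IsOpen Ω)
    (hz : ∃ x ∈ frontier Ω, T.nodalBasis z x ≠ 0) :
    ∃ x ∈ frontier Ω, ∀ t ∈ T.cells, z ∈ t → dist z x ≤ patchRatio σ * cellDiam t := by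
  obtain ⟨x, hx, hzx⟩ := hz
  obtain ⟨s, hs, hxs⟩ := T.exists_mem_tri (frontier_subset_closure hx)
  have hzs : z ∈ s := by_contra fun h => hzx (T.nodalBasis_of_notMem hs h hxs)
  by_cases hzΩ : z ∈ Ω
  · exact ⟨x, hx, fun t ht hzt => (dist_le_cellDiam (mem_tri hzs) hxs).trans
      (hσ.cellDiam_le_mul_cellDiam hΩ hzΩ ht hzt hs hzs)⟩
  · refine ⟨z, hΩ.frontier_eq ▸ ⟨T.tri_subset hs (mem_tri hzs), hzΩ⟩, fun t ht _ => ?_⟩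
    rw [dist_self]
    exact mul_nonneg (zero_le_one.trans (one_le_patchRatio σ)) (cellDiam_pos ht).le

lemma ShapeRegular.l2norm_tri_le (hσ : T.ShapeRegular σ) (hΩ : IsPolygonalDomain Ω) {c : ℝ}
    (hc : 0 < c) (hext : HasExteriorCorkscrew Ω (frontier Ω) c
      (2 * patchRatio σ * (Metric.diam (closure Ω) + 1)))
    (hu : MemH10 Ω u) (hz : ∃ x ∈ frontier Ω, T.nodalBasis z x ≠ 0) (ht : t ∈ T.cells)
    (hzt : z ∈ t) :
    l2norm (tri t) u ≤ 8 * patchRatio σ / c * cellDiam t * l2norm Ω (weakGrad Ω u) := by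
  obtain ⟨x, hx, hdist⟩ := hσ.exists_mem_frontier_dist_le hΩ.isOpen hz
  have hΛ := one_le_patchRatio σ
  have hdiam : cellDiam t ≤ Metric.diam (closure Ω) :=
    Metric.diam_mono (T.tri_subset ht) hΩ.isBounded.closure
  have ht0 : 0 < cellDiam t := cellDiam_pos ht
  refine (T.l2norm_tri_le_of_mem_frontier hΩ hc hext hu hx
    (R := 2 * patchRatio σ * cellDiam t) (by positivity) (by gcongr; linarith) ht
    (tri_subset_closedBall hzt (by nlinarith [hdist t ht hzt]))).trans_eq ?_
  ring

lemma ShapeRegular.exists_l2norm_sub_const_le (hσ : T.ShapeRegular σ) (hΩ : IsPolygonalDomain Ω)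
    (hu : MemH10 Ω u) (hzv : z ∈ T.vertices) (hz : z ∈ Ω) :
    ∃ a : ℝ, ∀ t ∈ T.cells, z ∈ t → l2norm (tri t) (fun x => u x - a)
      ≤ 4 * patchRatio σ ^ 2 * cellDiam t * l2norm Ω (weakGrad Ω u) := by
  obtain ⟨s, hs, hzs⟩ := T.mem_vertices.1 hzv
  have hΛ := one_le_patchRatio σ
  obtain ⟨y, -, hy⟩ := T.exists_l2norm_sub_const_le hΩ hu (x₀ := z) (y₀ := z)
    (R := patchRatio σ * cellDiam s) (c := 1)
    (mul_pos (by positivity) (cellDiam_pos hs)) one_pos (by rw [one_mul])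
  refine ⟨Ω.indicator u y, fun t ht hzt => (hy t ht (tri_subset_closedBall hzt ?_)).trans ?_⟩
  · simpa using hσ.cellDiam_le_mul_cellDiam hΩ.isOpen hz hs hzs ht hzt
  · have hcomp := hσ.cellDiam_le_mul_cellDiam hΩ.isOpen hz ht hzt hs hzs
    refine mul_le_mul_of_nonneg_right ?_ (l2norm_nonneg Ω (weakGrad Ω u))
    calc 4 * (patchRatio σ * cellDiam s) / 1
        ≤ 4 * (patchRatio σ * (patchRatio σ * cellDiam t)) := by rw [div_one]; gcongr
      _ = 4 * patchRatio σ ^ 2 * cellDiam t := by ring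

lemma exists_nodal_values (hΩ : IsPolygonalDomain Ω) (σ : ℝ) :
    ∃ M : ℝ, 0 ≤ M ∧ ∀ T : Triangulation Ω, T.ShapeRegular σ → ∀ u, MemH10 Ω u →
      ∃ a : Plane → ℝ, (∀ z, a z ≠ 0 → ∀ x ∈ frontier Ω, T.nodalBasis z x = 0) ∧
        ∀ t ∈ T.cells, ∀ z ∈ t, l2norm (tri t) (fun x => u x - a z)
          ≤ M * cellDiam t * l2norm Ω (weakGrad Ω u) := by
  have hΛ := one_le_patchRatio σ
  obtain ⟨c, hc, hext⟩ := hΩ.lipschitz.exists_hasExteriorCorkscrew_frontier hΩ.isOpen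
    hΩ.isBounded (D := 2 * patchRatio σ * (Metric.diam (closure Ω) + 1)) (by positivity)
  refine ⟨max (8 * patchRatio σ / c) (4 * patchRatio σ ^ 2), by positivity, fun T hσ u hu => ?_⟩
  have hN := l2norm_nonneg Ω (weakGrad Ω u)
  suffices h : ∀ z, ∃ a : ℝ, (a ≠ 0 → ∀ x ∈ frontier Ω, T.nodalBasis z x = 0) ∧
      ∀ t ∈ T.cells, z ∈ t → l2norm (tri t) (fun x => u x - a)
        ≤ max (8 * patchRatio σ / c) (4 * patchRatio σ ^ 2) * cellDiam t
          * l2norm Ω (weakGrad Ω u) by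
    choose a ha using h
    exact ⟨a, fun z => (ha z).1, fun t ht z hz => (ha z).2 t ht hz⟩
  intro z
  by_cases hbad : ∃ x ∈ frontier Ω, T.nodalBasis z x ≠ 0
  · refine ⟨0, by simp, fun t ht hzt => ?_⟩
    simp only [sub_zero]
    refine (hσ.l2norm_tri_le hΩ hc hext hu hbad ht hzt).trans ?_
    have := (cellDiam_pos ht).le
    gcongr
    exact le_max_left _ _
  by_cases hzv : z ∈ T.vertices
  · obtain ⟨s, hs, hzs⟩ := T.mem_vertices.1 hzv
    have hzΩ : z ∈ Ω := by
      by_contra hzΩ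
      refine hbad ⟨z, hΩ.isOpen.frontier_eq ▸ ⟨T.tri_subset hs (mem_tri hzs), hzΩ⟩, ?_⟩
      rw [T.nodalBasis_of_mem hs hzs (mem_tri hzs), bary_self hs ⟨z, hzs⟩]
      exact one_ne_zero
    obtain ⟨a, ha⟩ := hσ.exists_l2norm_sub_const_le hΩ hu hzv hzΩ
    refine ⟨a, fun _ x hx => not_not.1 fun h => hbad ⟨x, hx, h⟩,
      fun t ht hzt => (ha t ht hzt).trans ?_⟩
    have := (cellDiam_pos ht).le
    gcongr
    exact le_max_right _ _
  · exact ⟨0, by simp, fun t ht hzt => absurd (T.mem_vertices.2 ⟨t, ht, hzt⟩) hzv⟩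

lemma continuous_bary (ht : t ∈ T.cells) (z : t) : Continuous (T.bary t ht z) :=
  (contDiff_affineMap _).continuous

lemma l2norm_sub_sum_bary_le (ht : t ∈ T.cells) (hu : MemLp u 2 (volume.restrict (tri t)))
    {a : t → ℝ} {B : ℝ} (ha : ∀ z, l2norm (tri t) (fun x => u x - a z) ≤ B) :
    l2norm (tri t) (fun x => u x - ∑ z, T.bary t ht z x • a z) ≤ 3 * B := by
  have := isFiniteMeasure_restrict_of_isBounded (isCompact_tri t).isBounded
  have hmem : ∀ z, MemLp (fun x => u x - a z) 2 (volume.restrict (tri t)) := fun z =>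
    hu.sub (memLp_const (a z))
  have hle : ∀ z : t, ∀ᵐ x ∂(volume : Measure Plane).restrict (tri t),
      ‖T.bary t ht z x * (u x - a z)‖ ≤ 1 * ‖u x - a z‖ := fun z => by
    filter_upwards [ae_restrict_mem (isClosed_tri t).measurableSet] with x hx
    have hIcc := bary_mem_Icc ht z hx
    rw [norm_mul, Real.norm_of_nonneg hIcc.1]
    exact mul_le_mul_of_nonneg_right hIcc.2 (norm_nonneg _)
  have hpartition : ∀ x, u x - ∑ z, T.bary t ht z x • a z
      = ∑ z : t, T.bary t ht z x * (u x - a z) := fun x => by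
    simp only [mul_sub, smul_eq_mul, Finset.sum_sub_distrib, ← Finset.sum_mul, sum_bary, one_mul]
  simp only [hpartition]
  calc l2norm (tri t) (fun x => ∑ z : t, T.bary t ht z x * (u x - a z))
      ≤ ∑ z : t, l2norm (tri t) (fun x => T.bary t ht z x * (u x - a z)) :=
        l2norm_sum_le _ _ fun z _ => (hmem z).of_le_mul
          ((continuous_bary ht z).aestronglyMeasurable.mul (hmem z).1) (hle z)
    _ ≤ ∑ _z : t, B := Finset.sum_le_sum fun z _ =>
        (l2norm_le_mul zero_le_one (hmem z) (hle z)).trans (by simpa using ha z)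
    _ = 3 * B := by simp [T.card_eq t ht]

lemma norm_gradient_sum_bary_le (ht : t ∈ T.cells) {x₀ : Plane} {r : ℝ} (hr : 0 < r)
    (hb : Metric.closedBall x₀ r ⊆ tri t) (a : t → ℝ) (z₀ : t) (x : Plane) :
    ‖gradient (fun y => ∑ z, T.bary t ht z y • a z) x‖ ≤ 1 / r * ∑ z, ‖a z - a z₀‖ := by
  have hshift : (fun y => ∑ z, T.bary t ht z y • a z)
      = fun y => ∑ z, T.bary t ht z y • (a z - a z₀) + a z₀ := by
    funext y
    simp only [smul_eq_mul, mul_sub, Finset.sum_sub_distrib, ← Finset.sum_mul, sum_bary, one_mul,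
      sub_add_cancel]
  have hderiv := HasFDerivAt.fun_sum (u := Finset.univ) fun z _ =>
    (hasFDerivAt_affineMap (T.bary t ht z) x).smul_const (a z - a z₀)
  rw [norm_gradient, hshift, fderiv_add_const, hderiv.fderiv, Finset.mul_sum]
  refine (norm_sum_le _ _).trans (Finset.sum_le_sum fun z _ => ?_)
  rw [ContinuousLinearMap.norm_smulRight_apply]
  gcongr
  exact ContinuousLinearMap.opNorm_le_bound _ (by positivity) (abs_bary_linear_le ht z hr hb)

lemma l2norm_gradient_sum_bary_le (ht : t ∈ T.cells) (hu : MemLp u 2 (volume.restrict (tri t)))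
    {x₀ : Plane} {r : ℝ} (hr : 0 < r) (hb : Metric.closedBall x₀ r ⊆ tri t) {a : t → ℝ} {B : ℝ}
    (ha : ∀ z, l2norm (tri t) (fun x => u x - a z) ≤ B) :
    l2norm (tri t) (gradient fun x => ∑ z, T.bary t ht z x • a z) ≤ 6 * B / r := by
  have := isFiniteMeasure_restrict_of_isBounded (isCompact_tri t).isBounded
  obtain ⟨z₀, hz₀, -⟩ := T.exists_mem_ne ht 0
  have hmem : ∀ z, MemLp (fun x => u x - a z) 2 (volume.restrict (tri t)) := fun z =>
    hu.sub (memLp_const (a z))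
  have hdiff : ∀ z, l2norm (tri t) (fun _ => ‖a z - a ⟨z₀, hz₀⟩‖) ≤ B + B := fun z => by
    refine le_trans ?_ ((l2norm_sub_le (hmem ⟨z₀, hz₀⟩) (hmem z)).trans (add_le_add (ha _) (ha z)))
    rw [l2norm, eLpNorm_norm]
    simp only [sub_sub_sub_cancel_left]
    exact le_rfl
  calc l2norm (tri t) (gradient fun x => ∑ z, T.bary t ht z x • a z)
      ≤ 1 / r * l2norm (tri t) (fun _ => ∑ z, ‖a z - a ⟨z₀, hz₀⟩‖) :=
        l2norm_le_mul (by positivity) (memLp_const _) (.of_forall fun x =>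
          (norm_gradient_sum_bary_le ht hr hb a ⟨z₀, hz₀⟩ x).trans
            (mul_le_mul_of_nonneg_left (Real.le_norm_self _) (by positivity)))
    _ ≤ 1 / r * ∑ _z : t, (B + B) := by
        gcongr
        exact (l2norm_sum_le _ _ fun z _ => memLp_const _).trans
          (Finset.sum_le_sum fun z _ => hdiff z)
    _ = 6 * B / r := by simp [T.card_eq t ht]; ring

lemma sum_nodalBasis_eq_zero (T : Triangulation Ω) (hΩ : IsOpen Ω) {a : Plane → ℝ}
    (ha : ∀ z, a z ≠ 0 → ∀ x ∈ frontier Ω, T.nodalBasis z x = 0) {x : Plane} (hx : x ∉ Ω) :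
    ∑ z ∈ T.vertices, T.nodalBasis z x • a z = 0 := by
  refine Finset.sum_eq_zero fun z _ => ?_
  by_cases hxc : x ∈ closure Ω
  · rcases eq_or_ne (a z) 0 with haz | haz
    · rw [haz, smul_zero]
    · rw [ha z haz x (hΩ.frontier_eq ▸ ⟨hxc, hx⟩), zero_smul]
  · rw [T.nodalBasis_of_notMem_closure hxc, zero_smul]

lemma exists_quasi_interpolation (hΩ : IsPolygonalDomain Ω) (σ : ℝ) :
    ∃ M : ℝ, 0 ≤ M ∧ ∀ T : Triangulation Ω, T.ShapeRegular σ → ∀ u, MemH10 Ω u →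
      ∃ w, T.MemS0 w ∧ ∀ t ∈ T.cells,
        l2norm (tri t) (fun x => u x - w x) ≤ M * cellDiam t * l2norm Ω (weakGrad Ω u) ∧
        l2norm (tri t) (weakGrad Ω w) ≤ M * l2norm Ω (weakGrad Ω u) := by
  obtain ⟨M, hM, hnodal⟩ := exists_nodal_values hΩ σ
  refine ⟨max (3 * M) (6 * M * σ), by positivity, fun T hσ u hu => ?_⟩
  obtain ⟨a, ha0, ha⟩ := hnodal T hσ u hu
  have hN := l2norm_nonneg Ω (weakGrad Ω u)
  set w : Plane → ℝ := fun x => ∑ z ∈ T.vertices, T.nodalBasis z x • a z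
  have hw : T.IsPiecewiseAffine w := T.isPiecewiseAffine_sum_nodalBasis a
  have hgrad := hw.hasWeakGrad hΩ.isOpen
  refine ⟨w, ⟨⟨⟨_, hgrad⟩, hw⟩, hw.memH10 hΩ.isOpen fun x hx =>
    T.sum_nodalBasis_eq_zero hΩ.isOpen ha0 hx⟩, fun t ht => ?_⟩
  have hh : 0 < cellDiam t := cellDiam_pos ht
  have hut := hu.memLp.mono_measure (T.restrict_tri_le hΩ.volume_frontier ht)
  have hwt : Set.EqOn w (fun x => ∑ z : t, T.bary t ht z x • a z) (tri t) :=
    fun x hx => T.sum_nodalBasis ht a hx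
  obtain ⟨x₀, r, hr, hb, hreg⟩ := hσ t ht
  constructor
  · calc l2norm (tri t) (fun x => u x - w x)
        = l2norm (tri t) (fun x => u x - ∑ z : t, T.bary t ht z x • a z) := by
          refine l2norm_congr ?_
          filter_upwards [ae_restrict_mem (isClosed_tri t).measurableSet] with x hx
          rw [hwt hx]
      _ ≤ 3 * (M * cellDiam t * l2norm Ω (weakGrad Ω u)) :=
          l2norm_sub_sum_bary_le ht hut fun z => ha t ht z z.2
      _ = 3 * M * cellDiam t * l2norm Ω (weakGrad Ω u) := by ring
      _ ≤ _ := by gcongr; exact le_max_left _ _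
  · calc l2norm (tri t) (weakGrad Ω w)
        = l2norm (tri t) (gradient fun x => ∑ z : t, T.bary t ht z x • a z) := by
          refine l2norm_congr ?_
          filter_upwards [ae_mem_interior_tri t, ae_mono (T.restrict_tri_le hΩ.volume_frontier ht)
            (hgrad.weakGrad_ae_eq hΩ.isOpen)] with x hx hx'
          rw [hx', gradient, gradient,
            (hwt.eventuallyEq_of_mem (mem_interior_iff_mem_nhds.1 hx)).fderiv_eq]
      _ ≤ 6 * (M * cellDiam t * l2norm Ω (weakGrad Ω u)) / r :=
          l2norm_gradient_sum_bary_le ht hut hr hb fun z => ha t ht z z.2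
      _ = 6 * M * (cellDiam t / r) * l2norm Ω (weakGrad Ω u) := by ring
      _ ≤ 6 * M * σ * l2norm Ω (weakGrad Ω u) := by gcongr; exact (div_le_iff₀ hr).2 hreg
      _ ≤ _ := by gcongr; exact le_max_right _ _

lemma exists_memS0_l2norm_sub_le (hΩ : IsPolygonalDomain Ω) (σ : ℝ) :
    ∃ M : ℝ, 0 ≤ M ∧ ∀ T : Triangulation Ω, T.ShapeRegular σ → ∀ u, MemH10 Ω u →
      ∃ w, T.MemS0 w ∧ ∀ t ∈ T.cells,
        l2norm (tri t) (fun x => u x - w x) ≤ M * l2norm Ω (weakGrad Ω u) * cellDiam t ∧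
        l2norm (tri t) (weakGrad Ω fun x => u x - w x) ≤ M * l2norm Ω (weakGrad Ω u) := by
  obtain ⟨M, hM, hquasi⟩ := exists_quasi_interpolation hΩ σ
  refine ⟨1 + M, by positivity, fun T hσ u hu => ?_⟩
  obtain ⟨w, hw, hwt⟩ := hquasi T hσ u hu
  have hN := l2norm_nonneg Ω (weakGrad Ω u)
  refine ⟨w, hw, fun t ht => ⟨?_, ?_⟩⟩
  · have := (cellDiam_pos ht).le
    calc l2norm (tri t) (fun x => u x - w x)
        ≤ M * cellDiam t * l2norm Ω (weakGrad Ω u) := (hwt t ht).1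
      _ = M * l2norm Ω (weakGrad Ω u) * cellDiam t := by ring
      _ ≤ (1 + M) * l2norm Ω (weakGrad Ω u) * cellDiam t := by gcongr; linarith
  · have hle := T.restrict_tri_le hΩ.volume_frontier ht
    calc l2norm (tri t) (weakGrad Ω fun x => u x - w x)
        = l2norm (tri t) (fun x => weakGrad Ω u x - weakGrad Ω w x) :=
          l2norm_congr (ae_mono hle (weakGrad_sub_ae_eq hΩ.isOpen hu.1 hw.1.1))
      _ ≤ l2norm (tri t) (weakGrad Ω u) + l2norm (tri t) (weakGrad Ω w) :=
          l2norm_sub_le (hu.memLp_weakGrad.mono_measure hle) (hw.2.memLp_weakGrad.mono_measure hle)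
      _ ≤ l2norm Ω (weakGrad Ω u) + M * l2norm Ω (weakGrad Ω u) :=
          add_le_add (l2norm_mono_measure hle hu.memLp_weakGrad) (hwt t ht).2
      _ = (1 + M) * l2norm Ω (weakGrad Ω u) := by ring

end Triangulation

/-! ### Integration by parts -/

section IntegrationByParts

variable {F : Plane → Plane} {d v : Plane → ℝ}

lemma MemH10.abs_integral_inner_add_le (hF : MemLp F 2 (volume.restrict Ω))
    (hd : MemLp d 2 (volume.restrict Ω))
    (h : ∀ ψ, IsTestFunction Ω ψ →
      ∫ x in Ω, inner ℝ (F x) (gradient ψ x) = -∫ x in Ω, d x * ψ x)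
    (hv : MemH10 Ω v) {δ : ℝ} (hδ : 0 < δ) :
    |(∫ x in Ω, inner ℝ (F x) (weakGrad Ω v x)) + ∫ x in Ω, d x * v x|
      ≤ (l2norm Ω F + l2norm Ω d) * δ := by
  obtain ⟨ψ, hψ, hψv, hψg⟩ := hv.2 (ENNReal.ofReal δ) (by simpa using hδ)
  have hgrad : ∫ x in Ω, inner ℝ (F x) (weakGrad Ω v x - gradient ψ x)
      = (∫ x in Ω, inner ℝ (F x) (weakGrad Ω v x)) - ∫ x in Ω, inner ℝ (F x) (gradient ψ x) := by
    simp_rw [inner_sub_right]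
    exact integral_sub (integrable_inner_of_memLp hF hv.memLp_weakGrad)
      (integrable_inner_of_memLp hF (hψ.memLp_gradient 2 _))
  have hval : ∫ x in Ω, d x * (v x - ψ x)
      = (∫ x in Ω, d x * v x) - ∫ x in Ω, d x * ψ x := by
    simp_rw [mul_sub]
    exact integral_sub (hd.integrable_mul hv.memLp) (hd.integrable_mul (hψ.memLp 2 _))
  calc |(∫ x in Ω, inner ℝ (F x) (weakGrad Ω v x)) + ∫ x in Ω, d x * v x|
      = |(∫ x in Ω, inner ℝ (F x) (weakGrad Ω v x - gradient ψ x))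
          + ∫ x in Ω, d x * (v x - ψ x)| := by
        rw [hgrad, hval, h ψ hψ]
        ring_nf
    _ ≤ l2norm Ω F * δ + l2norm Ω d * δ := (abs_add_le _ _).trans <| add_le_add
        ((abs_integral_inner_le hF (hv.memLp_weakGrad.sub (hψ.memLp_gradient 2 _))).trans <|
          mul_le_mul_of_nonneg_left (ENNReal.toReal_le_of_le_ofReal hδ.le hψg.le)
            (l2norm_nonneg _ _))
        ((abs_integral_mul_le hd (hv.memLp.sub (hψ.memLp 2 _))).trans <|
          mul_le_mul_of_nonneg_left (ENNReal.toReal_le_of_le_ofReal hδ.le hψv.le)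
            (l2norm_nonneg _ _))
    _ = (l2norm Ω F + l2norm Ω d) * δ := by ring

lemma MemH10.integral_inner_eq_neg (hF : MemLp F 2 (volume.restrict Ω))
    (hd : MemLp d 2 (volume.restrict Ω))
    (h : ∀ ψ, IsTestFunction Ω ψ →
      ∫ x in Ω, inner ℝ (F x) (gradient ψ x) = -∫ x in Ω, d x * ψ x)
    (hv : MemH10 Ω v) :
    ∫ x in Ω, inner ℝ (F x) (weakGrad Ω v x) = -∫ x in Ω, d x * v x := by
  set A := l2norm Ω F + l2norm Ω d
  have hA : 0 ≤ A := add_nonneg (l2norm_nonneg _ _) (l2norm_nonneg _ _)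
  refine eq_neg_of_add_eq_zero_left (abs_nonpos_iff.1 (le_of_forall_pos_le_add fun η hη => ?_))
  calc |(∫ x in Ω, inner ℝ (F x) (weakGrad Ω v x)) + ∫ x in Ω, d x * v x|
      ≤ A * (η / (A + 1)) := hv.abs_integral_inner_add_le hF hd h (by positivity)
    _ ≤ 0 + η := by
        rw [zero_add, mul_div_assoc', div_le_iff₀ (by positivity)]
        nlinarith

end IntegrationByParts

namespace Triangulation.IsPiecewiseAffine

variable {T : Triangulation Ω} {F : Plane → Plane}

lemma apply (hF : T.IsPiecewiseAffine F) (k : Fin 2) : T.IsPiecewiseAffine fun x => F x k :=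
  fun t ht => (hF t ht).imp' (EuclideanSpace.proj k : Plane →L[ℝ] ℝ).toAffineMap.comp
    fun _ hl _ hx => congrArg (· k) (hl hx)

lemma divergence_ae_eq (hF : T.IsPiecewiseAffine F) (hΩ : MeasurableSet Ω) :
    ∀ᵐ x ∂(volume : Measure Plane).restrict Ω, divergence F x
      = ∑ k : Fin 2, inner ℝ (gradient (fun x => F x k) x) (EuclideanSpace.single k (1 : ℝ)) := by
  filter_upwards [hF.ae_differentiableAt hΩ] with x hx
  refine Finset.sum_congr rfl fun k _ => ?_
  have hcomp : HasFDerivAt (fun x => F x k)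
      ((EuclideanSpace.proj k : Plane →L[ℝ] ℝ).comp (fderiv ℝ F x)) x :=
    (EuclideanSpace.proj k : Plane →L[ℝ] ℝ).hasFDerivAt.comp x hx.hasFDerivAt
  rw [inner_gradient_left, hcomp.fderiv]
  rfl

lemma memLp_divergence (hF : T.IsPiecewiseAffine F) (hΩ : MeasurableSet Ω) :
    MemLp (divergence F) 2 (volume.restrict Ω) :=
  (memLp_congr_ae (hF.divergence_ae_eq hΩ)).2 <| memLp_finsetSum _ fun k _ =>
    ((hF.apply k).memLp_gradient hΩ 2).inner_const (EuclideanSpace.single k (1 : ℝ))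

lemma integral_inner_gradient_eq_neg (hF : T.IsPiecewiseAffine F) (hΩ : IsOpen Ω)
    {ψ : Plane → ℝ} (hψ : IsTestFunction Ω ψ) :
    ∫ x in Ω, inner ℝ (F x) (gradient ψ x) = -∫ x in Ω, divergence F x * ψ x := by
  have hcoord : ∀ x, inner ℝ (F x) (gradient ψ x)
      = ∑ k : Fin 2, F x k * fderiv ℝ ψ x (EuclideanSpace.single k 1) := fun x => by
    rw [PiLp.inner_apply]
    refine Finset.sum_congr rfl fun k _ => ?_
    rw [← inner_gradient_left, EuclideanSpace.inner_single_right]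
    simp [mul_comm]
  have hdiv : ∫ x in Ω, divergence F x * ψ x = ∫ x in Ω, ∑ k : Fin 2,
      inner ℝ (gradient (fun x => F x k) x) (EuclideanSpace.single k (1 : ℝ)) * ψ x := by
    refine integral_congr_ae ?_
    filter_upwards [hF.divergence_ae_eq hΩ.measurableSet] with x hx
    rw [hx, Finset.sum_mul]
  simp_rw [hcoord]
  rw [hdiv, integral_finsetSum, integral_finsetSum, ← Finset.sum_neg_distrib]
  · exact Finset.sum_congr rfl fun k _ => ((hF.apply k).hasWeakGrad hΩ).2.2 ψ hψ _
  · exact fun k _ =>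
      hψ.integrable_inner_mul ((hF.apply k).memLp_gradient hΩ.measurableSet 2) _
  · exact fun k _ => ((hF.apply k).memLp hΩ.measurableSet 2).integrable_mul
      (hψ.memLp_fderiv_apply 2 _ _)

lemma integral_inner_weakGrad_eq_neg (hF : T.IsPiecewiseAffine F) (hΩ : IsOpen Ω)
    {v : Plane → ℝ} (hv : MemH10 Ω v) :
    ∫ x in Ω, inner ℝ (F x) (weakGrad Ω v x) = -∫ x in Ω, divergence F x * v x :=
  hv.integral_inner_eq_neg (hF.memLp hΩ.measurableSet 2) (hF.memLp_divergence hΩ.measurableSet)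
    fun _ hψ => hF.integral_inner_gradient_eq_neg hΩ hψ

end Triangulation.IsPiecewiseAffine

/-! ### The a posteriori error estimate -/

section EnergyForm

variable {ε u v w : Plane → ℝ}

lemma memLp_smul_of_continuousOn (hΩ : IsOpen Ω) (hb : Bornology.IsBounded Ω)
    (hε : ContinuousOn ε (closure Ω)) {V : Type*} [NormedAddCommGroup V] [NormedSpace ℝ V]
    {F : Plane → V} {p : ENNReal} (hF : MemLp F p (volume.restrict Ω)) :
    MemLp (fun x => ε x • F x) p (volume.restrict Ω) := by
  obtain ⟨C, hC⟩ := hb.isCompact_closure.exists_bound_of_continuousOn hε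
  refine hF.of_le_mul (c := C)
    (((hε.mono subset_closure).aestronglyMeasurable hΩ.measurableSet).smul hF.1) ?_
  filter_upwards [ae_restrict_mem hΩ.measurableSet] with x hx
  rw [norm_smul]
  exact mul_le_mul_of_nonneg_right (hC x (subset_closure hx)) (norm_nonneg _)

lemma integrable_inner_smul_weakGrad (hΩ : IsOpen Ω) (hb : Bornology.IsBounded Ω)
    (hε : ContinuousOn ε (closure Ω)) (hu : MemH1 Ω u) (hv : MemH1 Ω v) :
    Integrable (fun x => inner ℝ (ε x • weakGrad Ω u x) (weakGrad Ω v x)) (volume.restrict Ω) :=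
  integrable_inner_of_memLp (memLp_smul_of_continuousOn hΩ hb hε hu.hasWeakGrad.2.1)
    hv.hasWeakGrad.2.1

lemma formE_sub_left (hΩ : IsOpen Ω) (hb : Bornology.IsBounded Ω)
    (hε : ContinuousOn ε (closure Ω)) (hu : MemH1 Ω u) (hv : MemH1 Ω v) (hw : MemH1 Ω w) :
    formE Ω ε (fun x => u x - v x) w = formE Ω ε u w - formE Ω ε v w := by
  rw [formE, formE, formE, ← integral_sub (integrable_inner_smul_weakGrad hΩ hb hε hu hw)
    (integrable_inner_smul_weakGrad hΩ hb hε hv hw)]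
  refine integral_congr_ae ?_
  filter_upwards [weakGrad_sub_ae_eq hΩ hu hv] with x hx
  rw [hx, smul_sub, inner_sub_left]

lemma formE_sub_right (hΩ : IsOpen Ω) (hb : Bornology.IsBounded Ω)
    (hε : ContinuousOn ε (closure Ω)) (hu : MemH1 Ω u) (hv : MemH1 Ω v) (hw : MemH1 Ω w) :
    formE Ω ε u (fun x => v x - w x) = formE Ω ε u v - formE Ω ε u w := by
  rw [formE, formE, formE, ← integral_sub (integrable_inner_smul_weakGrad hΩ hb hε hu hv)
    (integrable_inner_smul_weakGrad hΩ hb hε hu hw)]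
  refine integral_congr_ae ?_
  filter_upwards [weakGrad_sub_ae_eq hΩ hv hw] with x hx
  rw [hx, inner_sub_right]

lemma mul_sq_l2norm_weakGrad_le_formE (hΩ : IsOpen Ω) (hb : Bornology.IsBounded Ω)
    (hε : ContinuousOn ε (closure Ω)) {ε₀ : ℝ} (h : ∀ x ∈ Ω, ε₀ ≤ ε x) (hu : MemH1 Ω u) :
    ε₀ * l2norm Ω (weakGrad Ω u) ^ 2 ≤ formE Ω ε u u := by
  have hG := hu.hasWeakGrad.2.1
  rw [l2norm, sq_toReal_eLpNorm hG, ← integral_const_mul]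
  refine integral_mono_ae ((integrable_inner_of_memLp hG hG).const_mul _)
    (integrable_inner_smul_weakGrad hΩ hb hε hu hu) ?_
  filter_upwards [ae_restrict_mem hΩ.measurableSet] with x hx
  rw [real_inner_smul_left]
  exact mul_le_mul_of_nonneg_right (h x hx) real_inner_self_nonneg

end EnergyForm

lemma le_div_mul_of_mul_sq_le {c N M P η S : ℝ} (hc : 0 < c) (hN : 0 ≤ N) (hM : 0 ≤ M)
    (hP : 0 ≤ P) (hη : 0 ≤ η) (hS : 0 ≤ S) (h : c * N ^ 2 ≤ S * (P * N) + M * N * η) :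
    N ≤ (M + P + 1) / c * (η + S) := by
  rw [div_mul_eq_mul_div, le_div_iff₀ hc]
  rcases hN.eq_or_lt with rfl | hN
  · rw [zero_mul]
    positivity
  · calc N * c ≤ P * S + M * η := le_of_mul_le_mul_right (by linarith) hN
      _ ≤ (M + P + 1) * (η + S) := by nlinarith [mul_nonneg hP hη, mul_nonneg hM hS]

namespace Triangulation

variable {T : Triangulation Ω} {G : Plane → Plane} {ε ρ ρh φ φh : Plane → ℝ}

lemma integral_residual_add_integral_fluxDefect (hΩ : IsOpen Ω)
    (hε : ContinuousOn ε (closure Ω)) (hG : T.IsPiecewiseAffine G)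
    (hρh : MemLp ρh 2 (volume.restrict Ω)) (hφh : MemH1 Ω φh) {v : Plane → ℝ} (hv : MemH10 Ω v) :
    (∫ x in Ω, (ρh x + divergence G x) * v x)
        + ∫ x in Ω, inner ℝ (G x - ε x • weakGrad Ω φh x) (weakGrad Ω v x)
      = (∫ x in Ω, ρh x * v x) - formE Ω ε φh v := by
  have hres : ∫ x in Ω, (ρh x + divergence G x) * v x
      = (∫ x in Ω, ρh x * v x) + ∫ x in Ω, divergence G x * v x := by
    simp_rw [add_mul]
    exact integral_add (hρh.integrable_mul hv.memLp)
      ((hG.memLp_divergence hΩ.measurableSet).integrable_mul hv.memLp)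
  have hdefect : ∫ x in Ω, inner ℝ (G x - ε x • weakGrad Ω φh x) (weakGrad Ω v x)
      = (∫ x in Ω, inner ℝ (G x) (weakGrad Ω v x)) - formE Ω ε φh v := by
    simp_rw [inner_sub_left]
    exact integral_sub
      (integrable_inner_of_memLp (hG.memLp hΩ.measurableSet 2) hv.memLp_weakGrad)
      (integrable_inner_smul_weakGrad hΩ T.isBounded hε hφh hv.1)
  rw [hres, hdefect, hG.integral_inner_weakGrad_eq_neg hΩ hv]
  ring

/-- Galerkin orthogonality allows to subtract `w ∈ S^h_0`. -/
lemma formE_error_eq (hΩ : IsOpen Ω) (hε : ContinuousOn ε (closure Ω)) (hG : T.IsPiecewiseAffine G)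
    (hρ : MemLp ρ 2 (volume.restrict Ω)) (hρh : MemLp ρh 2 (volume.restrict Ω))
    (hφ : MemH10 Ω φ) (hφh : MemH10 Ω φh)
    (hpot : ∀ w, MemH10 Ω w → formE Ω ε φ w = ∫ x in Ω, ρ x * w x)
    (hpoth : ∀ w, T.MemS0 w → formE Ω ε φh w = ∫ x in Ω, ρh x * w x)
    {w : Plane → ℝ} (hw : T.MemS0 w) :
    formE Ω ε (fun x => φ x - φh x) (fun x => φ x - φh x)
      = (∫ x in Ω, (ρ x - ρh x) * (φ x - φh x))
        + ((∫ x in Ω, (ρh x + divergence G x) * (φ x - φh x - w x))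
          + ∫ x in Ω, inner ℝ (G x - ε x • weakGrad Ω φh x)
              (weakGrad Ω (fun x => φ x - φh x - w x) x)) := by
  have he : MemH10 Ω (fun x => φ x - φh x) := hφ.sub hΩ hφh
  have hdata : ∫ x in Ω, (ρ x - ρh x) * (φ x - φh x)
      = (∫ x in Ω, ρ x * (φ x - φh x)) - ∫ x in Ω, ρh x * (φ x - φh x) := by
    simp_rw [sub_mul]
    exact integral_sub (hρ.integrable_mul he.memLp) (hρh.integrable_mul he.memLp)
  have hsplit : ∫ x in Ω, ρh x * (φ x - φh x - w x)
      = (∫ x in Ω, ρh x * (φ x - φh x)) - ∫ x in Ω, ρh x * w x := by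
    simp_rw [mul_sub _ (φ _ - φh _)]
    exact integral_sub (hρh.integrable_mul he.memLp) (hρh.integrable_mul hw.2.memLp)
  rw [integral_residual_add_integral_fluxDefect hΩ hε hG hρh hφh.1 (he.sub hΩ hw.2),
    formE_sub_left hΩ T.isBounded hε hφ.1 hφh.1 he.1,
    formE_sub_right hΩ T.isBounded hε hφh.1 he.1 hw.1.1, hpot _ he, hpoth w hw, hdata, hsplit]
  ring

lemma integral_mul_add_integral_inner_le (T : Triangulation Ω) (hΩ : volume (frontier Ω) = 0)
    {R v : Plane → ℝ} {D F : Plane → Plane} (hR : MemLp R 2 (volume.restrict Ω))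
    (hv : MemLp v 2 (volume.restrict Ω)) (hD : MemLp D 2 (volume.restrict Ω))
    (hF : MemLp F 2 (volume.restrict Ω)) {m : ℝ}
    (h : ∀ t ∈ T.cells, l2norm (tri t) v ≤ m * cellDiam t ∧ l2norm (tri t) F ≤ m) :
    (∫ x in Ω, R x * v x) + ∫ x in Ω, inner ℝ (D x) (F x)
      ≤ m * ∑ t ∈ T.cells, (cellDiam t * l2norm (tri t) R + l2norm (tri t) D) := by
  have hRv : Integrable (fun x => R x * v x) (volume.restrict Ω) := hR.integrable_mul hv
  rw [T.integral_eq_sum hΩ hRv, T.integral_eq_sum hΩ (integrable_inner_of_memLp hD hF),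
    ← Finset.sum_add_distrib, Finset.mul_sum]
  refine Finset.sum_le_sum fun t ht => ?_
  have hle := T.restrict_tri_le hΩ ht
  calc (∫ x in tri t, R x * v x) + ∫ x in tri t, inner ℝ (D x) (F x)
      ≤ l2norm (tri t) R * l2norm (tri t) v + l2norm (tri t) D * l2norm (tri t) F :=
        add_le_add
          ((le_abs_self _).trans (abs_integral_mul_le (hR.mono_measure hle) (hv.mono_measure hle)))
          ((le_abs_self _).trans
            (abs_integral_inner_le (hD.mono_measure hle) (hF.mono_measure hle)))
    _ ≤ l2norm (tri t) R * (m * cellDiam t) + l2norm (tri t) D * m :=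
        add_le_add (mul_le_mul_of_nonneg_left (h t ht).1 (l2norm_nonneg _ _))
          (mul_le_mul_of_nonneg_left (h t ht).2 (l2norm_nonneg _ _))
    _ = m * (cellDiam t * l2norm (tri t) R + l2norm (tri t) D) := by ring

lemma formE_error_le (hΩ : IsOpen Ω) (h0 : volume (frontier Ω) = 0)
    (hε : ContinuousOn ε (closure Ω)) (hG : T.IsPiecewiseAffine G)
    (hρ : MemLp ρ 2 (volume.restrict Ω)) (hρh : MemLp ρh 2 (volume.restrict Ω))
    (hφ : MemH10 Ω φ) (hφh : MemH10 Ω φh)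
    (hpot : ∀ w, MemH10 Ω w → formE Ω ε φ w = ∫ x in Ω, ρ x * w x)
    (hpoth : ∀ w, T.MemS0 w → formE Ω ε φh w = ∫ x in Ω, ρh x * w x)
    {w : Plane → ℝ} (hw : T.MemS0 w) {m : ℝ}
    (h : ∀ t ∈ T.cells, l2norm (tri t) (fun x => φ x - φh x - w x) ≤ m * cellDiam t ∧
      l2norm (tri t) (weakGrad Ω fun x => φ x - φh x - w x) ≤ m) :
    formE Ω ε (fun x => φ x - φh x) (fun x => φ x - φh x)
      ≤ l2norm Ω (fun x => ρ x - ρh x) * l2norm Ω (fun x => φ x - φh x)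
        + m * ∑ t ∈ T.cells, (cellDiam t * l2norm (tri t) (fun x => ρh x + divergence G x)
          + l2norm (tri t) fun x => G x - ε x • weakGrad Ω φh x) := by
  have he := hφ.sub hΩ hφh
  have hd := he.sub hΩ hw.2
  rw [formE_error_eq hΩ hε hG hρ hρh hφ hφh hpot hpoth hw]
  exact add_le_add ((le_abs_self _).trans (abs_integral_mul_le (hρ.sub hρh) he.memLp))
    (T.integral_mul_add_integral_inner_le h0 (hρh.add (hG.memLp_divergence hΩ.measurableSet))
      hd.memLp ((hG.memLp hΩ.measurableSet 2).sub
        (memLp_smul_of_continuousOn hΩ T.isBounded hε hφh.memLp_weakGrad)) hd.memLp_weakGrad h)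

lemma exists_l2norm_weakGrad_sub_le (hΩ : IsPolygonalDomain Ω)
    (hε : ContinuousOn ε (closure Ω)) (hεpos : ∀ x ∈ closure Ω, 0 < ε x) (σ : ℝ) :
    ∃ C : ℝ, 0 < C ∧ ∀ T : Triangulation Ω, T.ShapeRegular σ →
      ∀ G : Plane → Plane, T.IsPiecewiseAffine G →
      ∀ ρ ρh : Plane → ℝ, MemLp ρ 2 (volume.restrict Ω) → MemLp ρh 2 (volume.restrict Ω) →
      ∀ φ φh : Plane → ℝ, MemH10 Ω φ → MemH10 Ω φh →
        (∀ w, MemH10 Ω w → formE Ω ε φ w = ∫ x in Ω, ρ x * w x) →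
        (∀ w, T.MemS0 w → formE Ω ε φh w = ∫ x in Ω, ρh x * w x) →
        l2norm Ω (weakGrad Ω fun x => φ x - φh x)
          ≤ C * (∑ t ∈ T.cells, (cellDiam t * l2norm (tri t) (fun x => ρh x + divergence G x)
              + l2norm (tri t) fun x => G x - ε x • weakGrad Ω φh x)
            + l2norm Ω fun x => ρ x - ρh x) := by
  obtain ⟨x₀, hx₀, hmin⟩ := hΩ.isBounded.isCompact_closure.exists_isMinOn
    hΩ.isConnected.nonempty.closure hε
  have hε₀ : 0 < ε x₀ := hεpos x₀ hx₀
  obtain ⟨M, hM, hquasi⟩ := exists_memS0_l2norm_sub_le hΩ σ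
  obtain ⟨P, hP, hpoincare⟩ := MemH10.l2norm_le_of_isBounded hΩ.isOpen hΩ.isBounded
  refine ⟨(M + P + 1) / ε x₀, by positivity,
    fun T hσ G hG ρ ρh hρ hρh φ φh hφ hφh hpot hpoth => ?_⟩
  have he := hφ.sub hΩ.isOpen hφh
  obtain ⟨w, hw, hwt⟩ := hquasi T hσ _ he
  have hupper := formE_error_le hΩ.isOpen hΩ.volume_frontier hε hG hρ hρh hφ hφh hpot hpoth hw hwt
  have hlower := mul_sq_l2norm_weakGrad_le_formE hΩ.isOpen hΩ.isBounded hε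
    (fun x hx => hmin (subset_closure hx)) he.1
  have hN := l2norm_nonneg Ω (weakGrad Ω fun x => φ x - φh x)
  have hS := l2norm_nonneg Ω fun x => ρ x - ρh x
  have hη : 0 ≤ ∑ t ∈ T.cells, (cellDiam t * l2norm (tri t) (fun x => ρh x + divergence G x)
      + l2norm (tri t) fun x => G x - ε x • weakGrad Ω φh x) := Finset.sum_nonneg fun t _ =>
    add_nonneg (mul_nonneg Metric.diam_nonneg (l2norm_nonneg _ _)) (l2norm_nonneg _ _)
  refine le_div_mul_of_mul_sq_le hε₀ hN hM hP hη hS (hlower.trans (hupper.trans ?_))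
  linarith [mul_le_mul_of_nonneg_left (hpoincare _ he) hS]

lemma isPiecewiseAffine_fluxRecovery (T : Triangulation Ω) (wt : Plane → Finset Plane → ℝ)
    (ε v : Plane → ℝ) : T.IsPiecewiseAffine (T.fluxRecovery wt ε v) :=
  T.isPiecewiseAffine_sum_nodalBasis _

end Triangulation

section Charge

variable {n : ℕ} {f : Plane → ℝ} {p ph : Fin n → Plane → ℝ}

lemma memLp_charge (q : Fin n → ℝ) {μ : Measure Plane} {r : ENNReal} (hf : MemLp f r μ)
    (hp : ∀ i, MemLp (p i) r μ) : MemLp (charge q f p) r μ :=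
  (memLp_finsetSum _ fun i _ => (hp i).const_mul (q i)).add hf

lemma l2norm_charge_sub_le (q : Fin n → ℝ) (f : Plane → ℝ)
    (hp : ∀ i, MemLp (p i) 2 (volume.restrict Ω))
    (hph : ∀ i, MemLp (ph i) 2 (volume.restrict Ω)) :
    l2norm Ω (fun x => charge q f p x - charge q f ph x)
      ≤ (∑ i, |q i|) * ∑ i, l2norm Ω (fun x => p i x - ph i x) := by
  have hdiff : ∀ x, charge q f p x - charge q f ph x = ∑ i, q i * (p i x - ph i x) := fun x => by
    simp only [charge, add_sub_add_right_eq_sub, ← Finset.sum_sub_distrib, mul_sub]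
  have hm : ∀ i, MemLp (fun x => p i x - ph i x) 2 (volume.restrict Ω) :=
    fun i => (hp i).sub (hph i)
  simp only [hdiff, Finset.sum_mul]
  refine (l2norm_sum_le _ _ fun i _ => (hm i).const_mul (q i)).trans
    (Finset.sum_le_sum fun i _ => ?_)
  calc l2norm Ω (fun x => q i * (p i x - ph i x))
      ≤ |q i| * l2norm Ω (fun x => p i x - ph i x) :=
        l2norm_le_mul (abs_nonneg _) (hm i) (.of_forall fun x => (norm_mul _ _).le)
    _ ≤ |q i| * ∑ j, l2norm Ω (fun x => p j x - ph j x) :=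
        mul_le_mul_of_nonneg_left (Finset.single_le_sum
          (f := fun j => l2norm Ω (fun x => p j x - ph j x)) (fun _ _ => l2norm_nonneg _ _)
          (Finset.mem_univ i)) (abs_nonneg _)

lemma estimator_eq (T : Triangulation Ω) (wt : Plane → Finset Plane → ℝ) (q : Fin n → ℝ)
    (ε f : Plane → ℝ) (ph : Fin n → Plane → ℝ) (φh : Plane → ℝ) :
    estimator T wt q ε f ph φh = ∑ t ∈ T.cells,
      (cellDiam t * l2norm (tri t)
          (fun x => charge q f ph x + divergence (T.fluxRecovery wt ε φh) x)
        + l2norm (tri t) fun x => T.fluxRecovery wt ε φh x - ε x • weakGrad Ω φh x) := by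
  have hres : residual T wt q ε f ph φh
      = fun x => charge q f ph x + divergence (T.fluxRecovery wt ε φh) x :=
    funext fun x => add_right_comm _ _ _
  rw [estimator, hres]
  rfl

end Charge

end PNP

end

open PNP in
theorem mainTheorem1_general {Ω : Set Plane} (hΩ : IsPolygonalDomain Ω) {n : ℕ} (q : Fin n → ℝ)
    {ε : Plane → ℝ} (hε : ContinuousOn ε (closure Ω)) (hεpos : ∀ x ∈ closure Ω, 0 < ε x) (σ : ℝ) :
    ∃ C : ℝ, 0 < C ∧ ∀ f : Plane → ℝ, MemLp f 2 (volume.restrict Ω) →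
      ∀ T : Triangulation Ω, T.ShapeRegular σ → ∀ wt : Plane → Finset Plane → ℝ,
      ∀ p ph : Fin n → Plane → ℝ, (∀ i, MemLp (p i) 2 (volume.restrict Ω)) →
        (∀ i, MemLp (ph i) 2 (volume.restrict Ω)) →
      ∀ φ φh : Plane → ℝ, MemH10 Ω φ → MemH10 Ω φh →
        (∀ w, MemH10 Ω w → formE Ω ε φ w = ∫ x in Ω, charge q f p x * w x) →
        (∀ w, T.MemS0 w → formE Ω ε φh w = ∫ x in Ω, charge q f ph x * w x) →
        l2norm Ω (weakGrad Ω fun x => φ x - φh x)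
          ≤ C * (estimator T wt q ε f ph φh + ∑ i, l2norm Ω fun x => p i x - ph i x) := by
  obtain ⟨C, hC, hbound⟩ := Triangulation.exists_l2norm_weakGrad_sub_le hΩ hε hεpos σ
  have hQ : 0 ≤ ∑ i, |q i| := Finset.sum_nonneg fun _ _ => abs_nonneg _
  refine ⟨C * (1 + ∑ i, |q i|), by positivity,
    fun f hf T hσ wt p ph hp hph φ φh hφ hφh hpot hpoth => ?_⟩
  have hη : 0 ≤ estimator T wt q ε f ph φh := Finset.sum_nonneg fun t _ =>
    add_nonneg (mul_nonneg Metric.diam_nonneg (l2norm_nonneg _ _)) (l2norm_nonneg _ _)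
  have hS : 0 ≤ ∑ i, l2norm Ω (fun x => p i x - ph i x) :=
    Finset.sum_nonneg fun _ _ => l2norm_nonneg _ _
  have hlinear := hbound T hσ _ (T.isPiecewiseAffine_fluxRecovery wt ε φh) _ _
    (memLp_charge q hf hp) (memLp_charge q hf hph) φ φh hφ hφh hpot hpoth
  rw [← estimator_eq] at hlinear
  refine hlinear.trans ?_
  rw [mul_assoc]
  refine mul_le_mul_of_nonneg_left ?_ hC.le
  nlinarith [l2norm_charge_sub_le q f hp hph, mul_nonneg hQ hη]

theorem mainTheorem1 (Ω : Set PNP.Plane) (hΩ : PNP.IsPolygonalDomain Ω)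
    (n : ℕ) (q : Fin n → ℝ)
    (ε : PNP.Plane → ℝ) (hε : ContDiffOn ℝ ∞ ε (closure Ω)) (hεpos : ∀ x ∈ closure Ω, 0 < ε x)
    (σ : ℝ) :
    ∃ C : ℝ, 0 < C ∧
      ∀ (α : PNP.Plane → ℝ → ℝ) (β : PNP.Plane → ℝ → PNP.Plane) (γ g : PNP.Plane → ℝ → ℝ)
        (f : PNP.Plane → ℝ),
        ContDiffOn ℝ ∞ (fun z : PNP.Plane × ℝ => α z.1 z.2) (closure Ω ×ˢ Set.univ) →
        ContDiffOn ℝ ∞ (fun z : PNP.Plane × ℝ => β z.1 z.2) (closure Ω ×ˢ Set.univ) →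
        ContDiffOn ℝ ∞ (fun z : PNP.Plane × ℝ => γ z.1 z.2) (closure Ω ×ˢ Set.univ) →
        ContDiffOn ℝ ∞ (fun z : PNP.Plane × ℝ => g z.1 z.2) (closure Ω ×ˢ Set.univ) →
        MemLp f 2 (volume.restrict Ω) →
      ∀ (T : PNP.Triangulation Ω), T.ShapeRegular σ →
      ∀ (wt : PNP.Plane → Finset PNP.Plane → ℝ), T.IsAveragingWeight wt →
      ∀ (p : Fin n → PNP.Plane → ℝ) (φ : PNP.Plane → ℝ),
        PNP.IsWeakSolution Ω q α β γ g ε f p φ →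
      ∀ (ph : Fin n → PNP.Plane → ℝ) (φh : PNP.Plane → ℝ),
        PNP.IsFESolution T q α β γ g ε f ph φh →
        PNP.l2norm Ω (PNP.weakGrad Ω (fun x => φ x - φh x)) ≤
          C * (PNP.estimator T wt q ε f ph φh
            + ∑ i, PNP.l2norm Ω (fun x => p i x - ph i x)) := by
  have ⟨C, hC, hbound⟩ := mainTheorem1_general hΩ q hε.continuousOn hεpos σ
  exact ⟨C, hC, fun _ _ _ _ f _ _ _ _ hf T hσ wt _ p φ hsol ph φh hfe =>
    hbound f hf T hσ wt p ph (fun i => (hsol.p_mem i).memLp) (fun i => (hfe.p_mem i).2.memLp)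
      φ φh hsol.phi_mem hfe.phi_mem.2 hsol.potential hfe.potential⟩
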